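/- Let $n\ge 2$ and let $\mathfrak B=\{\mathfrak x_1,\dots,\mathfrak x_n\}\subset S^2$ be a set of $n$ distinct points. Let $x_i\in H_1(S^2\setminus\mathfrak B;\mathbb Z)$ be the homology class of a small loop enclosing $\mathfrak x_i$ (all loops oriented consistently with a fixed orientation of $S^2$). For a finite abelian group $A$, a regular $A$-cover $\pi:\Sigma\to S^2$ with branching set $\mathfrak B$ is a branched covering by a connected closed surface $\Sigma$, unbranched over $S^2\setminus\mathfrak B$, together with an action of $A$ on $\Sigma$ by homeomorphisms whose orbits are the fibres of $\pi$ and which is free over $S^2\setminus\mathfrak B$. It determines an epimorphism $\phi_\pi:H_1(S^2\setminus\mathfrak B;\mathbb Z)\to A$: for a loop $\gamma$ in $S^2\setminus\mathfrak B$ and a lift $\tilde\gamma$ of $\gamma$ to $\Sigma$, the element $\phi_\pi([\gamma])$ carries $\tilde\gamma(0)$ to $\tilde\gamma(1)$. Two such covers $\pi:\Sigma\to S^2$ and $\pi':\Sigma'\to S^2$ are equivalent if there are homeomorphisms $\tilde g:\Sigma\to\Sigma'$ and $g:S^2\to S^2$ with $g(\mathfrak B)=\mathfrak B$ and $g\circ\pi=\pi'\circ\tilde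 g$. Theorem. Let $p$ be a prime, let $A$ be a finite abelian $p$-group of exponent $p^k$, and let $\pi:\Sigma\to S^2$ be a regular $A$-cover with branching set $\mathfrak B$ such that every homeomorphism $f$ of $S^2$ with $f(\mathfrak B)=\mathfrak B$ lifts to a homeomorphism $\tilde f$ of $\Sigma$, i.e. $\pi\circ\tilde f=f\circ\pi$. Then, after replacing $\pi$ by an equivalent cover and identifying $A$ with the stated group through an isomorphism, one of the following holds, where $\mathbf e_i$ is the vector with $1$ in position $i$ and $0$ elsewhere: (1) $A=\mathbb Z_{p^k}^{\,n-1}$ and $\phi_\pi(x_i)=\mathbf e_i$ for $1\le i\le n-1$; (2) $A=\mathbb Z_{p^r}^{\,n-2}\times\mathbb Z_{p^k}$ for some integer $r$ with $k>r>0$ and $p^{k-r}\mid n$, and $\phi_\pi(x_i)=(\mathbf e_i,1)$ for $1\le i\le n-2$, while $\phi_\pi(x_{n-1})=(\mathbf 0,1)$; (3) $A=\mathbb Z_{p^k}$ with $p^k\mid n$, and $\phi_\pi(x_i)=1$ for all $1\le i\le n$. -/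

import Mathlib

open Topology

universe u u' v v'

namespace BranchedCover

/-- The 2-sphere `S²`: the unit sphere of Euclidean 3-space. -/
abbrev Sphere : Type := Metric.sphere (0 : EuclideanSpace ℝ (Fin 3)) 1

/-- The first homology group `H₁(X; ℤ)` of a path-connected space `X`, as the abelianization of the
fundamental group (written additively). -/
abbrev H1 (X : Type*) [TopologicalSpace X] (x₀ : X) : Type _ :=
  Additive (Abelianization (FundamentalGroup X x₀))

/-- The class in `H₁(X; ℤ)` of a loop based at the base point. -/
noncomputable def H1.ofLoop {X : Type*} [TopologicalSpace X] {x₀ : X} (γ : Path x₀ x₀) : H1 X x₀ :=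
  Additive.ofMul (Abelianization.of (FundamentalGroup.fromPath (Path.Homotopic.Quotient.mk γ)))

/-- The class in `H₁(X; ℤ)` of a loop `γ` based anywhere: `γ` is joined to the base point by a path
`δ`, whose choice does not matter. -/
noncomputable def H1.ofFreeLoop {X : Type*} [TopologicalSpace X] {x₀ y : X} (δ : Path x₀ y) (γ : Path y y) :
    H1 X x₀ :=
  H1.ofLoop ((δ.trans γ).trans δ.symm)

/-- A regular `A`-cover `π : Σ → S²` (with `A` an abelian group, written additively) whose branching
is confined to the set `B`: a connected closed surface `Σ` with an action of `A` whose orbits are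
the fibres of `π`, such that `π` looks locally like `z ↦ z ^ m`, and such that away from `B` the
map `π` is an unbranched covering on which `A` acts freely. -/
structure RegularCover (A : Type v) [AddCommGroup A] (B : Set Sphere) : Type (max (u + 1) v) where
  /-- the covering surface `Σ` -/
  carrier : Type u
  [topologicalSpace : TopologicalSpace carrier]
  [t2Space : T2Space carrier]
  [compactSpace : CompactSpace carrier]
  [connectedSpace : ConnectedSpace carrier]
  [addAction : AddAction A carrier]
  [continuousConstVAdd : ContinuousConstVAdd A carrier]
  /-- the branched covering map `π` -/
  proj : carrier → Sphere
  continuous_proj : Continuous proj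
  surjective_proj : Function.Surjective proj
  proj_eq_iff : ∀ y z : carrier, proj y = proj z ↔ ∃ a : A, a +ᵥ y = z
  free_off_branch : ∀ (a : A) (y : carrier), proj y ∉ B → a +ᵥ y = y → a = 0
  isCoveringMapOn : IsCoveringMapOn proj Bᶜ
  local_form : ∀ y : carrier, ∃ m : ℕ, 0 < m ∧
    ∃ (e : OpenPartialHomeomorph carrier ℂ) (e' : OpenPartialHomeomorph Sphere ℂ),
      y ∈ e.source ∧ e y = 0 ∧ proj y ∈ e'.source ∧ e' (proj y) = 0 ∧
      ∀ z ∈ e.source, proj z ∈ e'.source ∧ e' (proj z) = e z ^ m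

namespace RegularCover

attribute [instance] topologicalSpace t2Space compactSpace connectedSpace addAction
  continuousConstVAdd

section

variable {A : Type v} [AddCommGroup A] {B : Set Sphere} (P : RegularCover.{u, v} A B)

/-- The unbranched part of `Σ`, lying over `S² \ B`. -/
abbrev Unbranched : Type u := ↥(P.proj ⁻¹' Bᶜ)

/-- The unbranched covering `Σ \ π⁻¹(B) → S² \ B`. -/
abbrev unbranchedProj : P.Unbranched → ↥(Bᶜ) := Set.restrictPreimage Bᶜ P.proj

theorem proj_vadd (a : A) (y : P.carrier) : P.proj (a +ᵥ y) = P.proj y :=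
  ((P.proj_eq_iff y (a +ᵥ y)).mpr ⟨a, rfl⟩).symm

/-- The action of `A` restricted to the unbranched part. -/
instance : AddAction A P.Unbranched where
  vadd a y := ⟨a +ᵥ y.1, by
    have h := y.2
    rw [Set.mem_preimage] at h ⊢
    rwa [P.proj_vadd]⟩
  zero_vadd y := Subtype.ext (zero_vadd A y.1)
  add_vadd a b y := Subtype.ext (add_vadd a b y.1)

theorem coe_vadd (a : A) (y : P.Unbranched) : ((a +ᵥ y : P.Unbranched) : P.carrier) = a +ᵥ y.1 :=
  rfl

theorem isCoveringMap_unbranchedProj : IsCoveringMap P.unbranchedProj :=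
  P.isCoveringMapOn.isCoveringMap_restrictPreimage

theorem surjective_unbranchedProj : Function.Surjective P.unbranchedProj := by
  rintro ⟨x, hx⟩
  obtain ⟨y, rfl⟩ := P.surjective_proj x
  exact ⟨⟨y, hx⟩, rfl⟩

/-- The unbranched part is a regular covering with group `A`. -/
theorem isAddQuotientCoveringMap : IsAddQuotientCoveringMap P.unbranchedProj A where
  toIsQuotientMap := P.isCoveringMap_unbranchedProj.isQuotientMap P.surjective_unbranchedProj
  continuous_const_vadd a :=
    ((continuous_const_vadd a).comp continuous_subtype_val).subtype_mk _
  apply_eq_iff_mem_orbit {y z} := by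
    constructor
    · intro h
      obtain ⟨a, ha⟩ := (P.proj_eq_iff z.1 y.1).mp (congrArg Subtype.val h).symm
      exact ⟨a, Subtype.ext ha⟩
    · rintro ⟨a, rfl⟩
      exact Subtype.ext (P.proj_vadd a z.1)
  disjoint y := by
    obtain ⟨e, hy, he⟩ := P.isCoveringMap_unbranchedProj.isLocalHomeomorph y
    refine ⟨e.source, e.open_source.mem_nhds hy, ?_⟩
    rintro a ⟨_, ⟨z, hz, rfl⟩, hz'⟩
    have h : a +ᵥ z = z := e.injOn hz' hz (by
      rw [← he]
      exact Subtype.ext (P.proj_vadd a z.1))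
    exact P.free_off_branch a z.1 z.2 (congrArg Subtype.val h)

/-- The homomorphism `φ_π : H₁(S² \ B; ℤ) → A` of the regular `A`-cover `π`: it sends the class of a
loop `γ` to the element of `A` that carries the starting point of any lift of `γ` to its end
point (see `monodromy_ofLoop_vadd`). -/
noncomputable def monodromy (x₀ : ↥(Bᶜ)) : H1 ↥(Bᶜ) x₀ →+ A :=
  MonoidHom.toAdditiveLeft (Abelianization.lift
    ((MulOpposite.opMulEquiv (M := Multiplicative A)).symm.toMonoidHom.comp
      (P.isAddQuotientCoveringMap.fundamentalGroupToMulOpposite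
        ⟨(P.surjective_unbranchedProj x₀).choose, (P.surjective_unbranchedProj x₀).choose_spec⟩)))

/-- The defining property of `φ_π`: if `Γ` is a lift of the loop `γ`, then
`Γ(1) = φ_π([γ]) + Γ(0)`. -/
theorem monodromy_ofLoop_vadd {x₀ : ↥(Bᶜ)} (γ : Path x₀ x₀) (Γ : C(unitInterval, P.Unbranched))
    (hΓ : ∀ t, P.unbranchedProj (Γ t) = γ t) :
    P.monodromy x₀ (H1.ofLoop γ) +ᵥ Γ 0 = Γ 1 := by
  have hq := P.isAddQuotientCoveringMap
  have hcov := P.isCoveringMap_unbranchedProj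
  obtain ⟨e, he⟩ : ∃ e : P.unbranchedProj ⁻¹' {x₀}, e =
    ⟨(P.surjective_unbranchedProj x₀).choose, (P.surjective_unbranchedProj x₀).choose_spec⟩ :=
    ⟨_, rfl⟩
  have h1 : P.monodromy x₀ (H1.ofLoop γ) +ᵥ e.1 =
      (hcov.monodromy (Path.Homotopic.Quotient.mk γ) e).1 := by
    have h := hq.unop_fundamentalGroupToMulOpposite_smul (e := e)
      (γ := FundamentalGroup.fromPath (Path.Homotopic.Quotient.mk γ))
    rw [he] at h ⊢
    exact h
  have h0 : P.unbranchedProj (Γ 0) = x₀ := (hΓ 0).trans γ.source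
  obtain ⟨a, ha⟩ := hq.toMultiplicative.exists_toPermFiber_eq e ⟨Γ 0, h0⟩
  have h2 := hq.monodromy_toPermFiber (g := a.toAdd) (γ := Path.Homotopic.Quotient.mk γ) (e := e)
  have hΓ1 : (hcov.monodromy (Path.Homotopic.Quotient.mk γ) ⟨Γ 0, h0⟩).1 = Γ 1 := by
    have := (hcov.eq_liftPath_iff' (γ := γ.toContinuousMap) (e := Γ 0) (by
      simpa using h0.symm)).mpr ⟨funext fun t ↦ hΓ t, rfl⟩
    exact (congrArg (fun F : C(unitInterval, P.Unbranched) ↦ F 1) this).symm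
  have ha' : a.toAdd +ᵥ e.1 = Γ 0 := congrArg Subtype.val ha
  have h3 : (hcov.monodromy (Path.Homotopic.Quotient.mk γ) ⟨Γ 0, h0⟩).1 =
      a.toAdd +ᵥ (hcov.monodromy (Path.Homotopic.Quotient.mk γ) e).1 := by
    rw [← ha]
    exact congrArg Subtype.val h2
  rw [← hΓ1, h3, ← h1, ← ha', vadd_vadd, vadd_vadd, add_comm]

/-- The homeomorphism `f` of `S²` lifts to a homeomorphism of `Σ`. -/
def Lifts (f : Sphere ≃ₜ Sphere) : Prop :=
  ∃ F : P.carrier ≃ₜ P.carrier, ∀ y, P.proj (F y) = f (P.proj y)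

/-- Equivalence of two covers with the same branching set `B`: there are homeomorphisms
`Σ → Σ'` and `g` of `S²` that commute with the covering maps, with `g(B) = B`. -/
def Equivalent {A' : Type v'} [AddCommGroup A'] (P : RegularCover.{u, v} A B)
    (Q : RegularCover.{u', v'} A' B) : Prop :=
  ∃ (G : P.carrier ≃ₜ Q.carrier) (g : Sphere ≃ₜ Sphere),
    g '' B = B ∧ ∀ y, g (P.proj y) = Q.proj (G y)

end

end RegularCover

/-- `γ` is a loop enclosing the `i`-th branch point `b i`: it runs once, counterclockwise as seen
from outside the sphere, around the boundary of a round disc of angular radius `ε` with centre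
`b i` that contains no other branch point. -/
def IsSmallLoop {n : ℕ} (b : Fin n → Sphere) (i : Fin n) {y : ↥((Set.range b)ᶜ)}
    (γ : Path y y) : Prop :=
  ∃ (ε : ℝ) (v w : EuclideanSpace ℝ (Fin 3)),
    0 < ε ∧ ε < Real.pi ∧
    (∀ j, j ≠ i → inner ℝ (b i).1 (b j).1 < Real.cos ε) ∧
    Orthonormal ℝ ![v, w, (b i).1] ∧
    (Matrix.of ![v.ofLp, w.ofLp, (b i).1.ofLp]).det = 1 ∧
    ∀ t : unitInterval, ((γ t).1.1 : EuclideanSpace ℝ (Fin 3)) =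
      Real.cos ε • (b i).1 + Real.sin ε •
        (Real.cos (2 * Real.pi * t) • v + Real.sin (2 * Real.pi * t) • w)

/-- `x` is the homology class in `H₁(S² \ {b 1, …, b n}; ℤ)` of a small loop enclosing `b i`. -/
def IsLoopClass {n : ℕ} (b : Fin n → Sphere) (x₀ : ↥((Set.range b)ᶜ)) (i : Fin n)
    (x : H1 ↥((Set.range b)ᶜ) x₀) : Prop :=
  ∃ (y : ↥((Set.range b)ᶜ)) (δ : Path x₀ y) (γ : Path y y),
    IsSmallLoop b i γ ∧ x = H1.ofFreeLoop δ γ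

end BranchedCover

/-! The cover `Q` is `P` itself; the content is a computation of the family `a j` in `A`, where `a
j` is the displacement produced by lifting a small circle around `b j`. Three facts about this
family suffice. It generates `A`, because the surface stays path-connected after removal of the
finitely many points over the branch set. Its sum is zero. Every transposition of its members is
induced by an endomorphism of `A`.

The first two facts rest on `exists_monodromy_eq_sum_winding`: in an abelian covering of a punctured
plane, the displacement along a lifted closed curve is an integral combination of winding numbers,
with coefficients that depend only on the covering. This replaces a computation of the homology of
the punctured sphere. It is transported to the sphere by stereographic projection from an arbitrary
pole (`RegularCover.exists_monodromy_formula`). With a branch point as pole, a circle around another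
branch point has winding number -1 about its centre and 0 elsewhere, while a circle around the pole
has winding number 1 about every puncture; hence the sum is zero (`exists_isLocalMonodromy`).

For the third fact, two branch points that lie on a cap with no other branch point are exchanged by
a half-twist of that cap. Its lift to the surface normalizes the action of `A` and so induces an
endomorphism. Since the twist is isotopic to the identity through maps fixing the pole, it preserves
winding numbers, so the endomorphism permutes the `a j` accordingly (`exists_hom_swap`). Arguing on
a closest bad pair, such transpositions yield all others (`exists_hom_perm`).

The rest is algebra. Applying a transposition to a relation with coefficients `c` and subtracting
gives `(c i - c j) • (a i - a j) = 0`. All differences of distinct members have one order `p ^ r`,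
and all members have order `p ^ k`. Thus the relations among the first `n - 1` members are exactly
those with every coefficient divisible by `p ^ r` and coefficient sum divisible by `p ^ k`. This
determines `A` with its generators, and the cases `r = k`, `0 < r < k`, `r = 0` are the three
alternatives (`SwapInvariant.classification`). -/

namespace BranchedCover

open Filter Complex

local notation "E3" => EuclideanSpace ℝ (Fin 3)

/-! ### Displacements in the fibres of a regular abelian covering -/

section Torsor

variable {E X A : Type*} [TopologicalSpace E] [TopologicalSpace X] [AddCommGroup A] [AddAction A E]

/-- The element of `A` carrying `e` to `e'`, if there is one. -/
noncomputable def fiberDiff (A : Type*) {E : Type*} [AddCommGroup A] [AddAction A E]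
    (e e' : E) : A :=
  open Classical in if h : ∃ a : A, a +ᵥ e = e' then h.choose else 0

variable {q : E → X} (hq : IsAddQuotientCoveringMap q A)
include hq

theorem exists_vadd_eq {e e' : E} (h : q e = q e') : ∃ a : A, a +ᵥ e = e' :=
  hq.apply_eq_iff_mem_orbit.mp h.symm

theorem vadd_right_injective {a b : A} {e : E} (h : a +ᵥ e = b +ᵥ e) : a = b :=
  have := hq.isCancelVAdd
  IsCancelVAdd.right_cancel _ _ e h

theorem fiberDiff_eq {e e' : E} {a : A} (h : a +ᵥ e = e') : fiberDiff A e e' = a := by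
  have h' : ∃ a : A, a +ᵥ e = e' := ⟨a, h⟩
  rw [fiberDiff, dif_pos h']
  exact vadd_right_injective hq (h'.choose_spec.trans h.symm)

theorem fiberDiff_vadd {e e' : E} (h : q e = q e') : fiberDiff A e e' +ᵥ e = e' := by
  obtain ⟨a, ha⟩ := exists_vadd_eq hq h
  rw [fiberDiff_eq hq ha, ha]

/-- Near `e₂` there is a neighbourhood disjoint from all its nontrivial translates. Both `a +ᵥ f₁ t`
and `f₂ t` eventually lie in it and share an orbit, so they coincide. -/
theorem eventually_vadd_eq {T : Type*} {l : Filter T} {f₁ f₂ : T → E} {e₁ e₂ : E}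
    (h₁ : Tendsto f₁ l (𝓝 e₁)) (h₂ : Tendsto f₂ l (𝓝 e₂)) {a : A} (ha : a +ᵥ e₁ = e₂)
    (h : ∀ᶠ t in l, q (f₁ t) = q (f₂ t)) : ∀ᶠ t in l, a +ᵥ f₁ t = f₂ t := by
  obtain ⟨U, hU, hU'⟩ := hq.disjoint e₂
  have hc := hq.continuous_const_vadd a
  have h₁' : Tendsto (fun t ↦ a +ᵥ f₁ t) l (𝓝 e₂) := ha ▸ (hc.tendsto e₁).comp h₁
  filter_upwards [h, h₁' hU, h₂ hU] with t ht ht₁ ht₂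
  obtain ⟨g, hg⟩ := exists_vadd_eq hq ((hq.map_vadd a).trans ht)
  have := hU' g ⟨f₂ t, ⟨_, ht₁, hg⟩, ht₂⟩
  rw [← hg, this, zero_vadd]

theorem eventually_fiberDiff_eq {T : Type*} {l : Filter T} {f₁ f₂ : T → E} {e₁ e₂ : E}
    (h₁ : Tendsto f₁ l (𝓝 e₁)) (h₂ : Tendsto f₂ l (𝓝 e₂)) (h₀ : q e₁ = q e₂)
    (h : ∀ᶠ t in l, q (f₁ t) = q (f₂ t)) :
    ∀ᶠ t in l, fiberDiff A (f₁ t) (f₂ t) = fiberDiff A e₁ e₂ :=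
  (eventually_vadd_eq hq h₁ h₂ (fiberDiff_vadd hq h₀) h).mono fun _ ↦ fiberDiff_eq hq

/-- The displacement is locally constant. This serves both for the period of a logarithmic cover and
for the conjugation of the covering group by a lifted homeomorphism. -/
theorem fiberDiff_eq_of_isPreconnected {T : Type*} [TopologicalSpace T] [PreconnectedSpace T]
    {f₁ f₂ : T → E} (h₁ : Continuous f₁) (h₂ : Continuous f₂) (h : ∀ t, q (f₁ t) = q (f₂ t))
    (s t : T) : fiberDiff A (f₁ s) (f₂ s) = fiberDiff A (f₁ t) (f₂ t) := by
  have : IsLocallyConstant fun t ↦ fiberDiff A (f₁ t) (f₂ t) :=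
    (IsLocallyConstant.iff_eventually_eq _).mpr fun t ↦
      eventually_fiberDiff_eq hq (h₁.tendsto t) (h₂.tendsto t) (h t) (Eventually.of_forall h)
  exact this.apply_eq_of_preconnectedSpace s t

end Torsor

/-! ### Simultaneous logarithms -/

/-- A compatible choice of logarithms of `z - β j`. -/
def IsLog {ι : Type*} (β : ι → ℂ) (z : ℂ) (ζ : ι → ℂ) : Prop := ∀ j, exp (ζ j) = z - β j

section Log

variable {ι : Type*} {β : ι → ℂ}

theorem exists_isLog {z : ℂ} (hz : z ∈ (Set.range β)ᶜ) : ∃ ζ, IsLog β z ζ :=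
  ⟨fun j ↦ log (z - β j), fun j ↦ exp_log (sub_ne_zero.mpr fun h ↦ hz ⟨j, h.symm⟩)⟩

theorem IsLog.add_int {z : ℂ} {ζ : ι → ℂ} (h : IsLog β z ζ) (m : ι → ℤ) :
    IsLog β z fun j ↦ ζ j + m j * (2 * Real.pi * I) := fun j ↦ by
  rw [exp_add, exp_int_mul_two_pi_mul_I, mul_one, h j]

theorem IsLog.exists_int {z : ℂ} {ζ ζ' : ι → ℂ} (h : IsLog β z ζ) (h' : IsLog β z ζ') :
    ∃ m : ι → ℤ, ζ' = fun j ↦ ζ j + m j * (2 * Real.pi * I) := by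
  choose m hm using fun j ↦ exp_eq_exp_iff_exists_int.mp ((h' j).trans (h j).symm)
  exact ⟨m, funext hm⟩

theorem two_pi_I_int_injective {m n : ℤ} (h : (m : ℂ) * (2 * Real.pi * I) = n * (2 * Real.pi * I)) :
    m = n := by
  have := mul_right_cancel₀ two_pi_I_ne_zero h
  exact_mod_cast this

/-- The difference tends to zero and is a multiple of `2πi`, so it vanishes once its norm is below
`2π`. -/
theorem eventually_eq_of_exp_eq {T : Type*} {l : Filter T} {f₁ f₂ : T → ℂ} {z : ℂ}
    (h₁ : Tendsto f₁ l (𝓝 z)) (h₂ : Tendsto f₂ l (𝓝 z)) (h : ∀ᶠ t in l, exp (f₁ t) = exp (f₂ t)) :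
    ∀ᶠ t in l, f₁ t = f₂ t := by
  have hb := (h₁.sub h₂)
  rw [sub_self] at hb
  have : ∀ᶠ t in l, ‖f₁ t - f₂ t‖ < 2 * Real.pi := by
    have := hb.norm
    rw [norm_zero] at this
    exact this.eventually_lt_const Real.two_pi_pos
  filter_upwards [this, h] with t ht he
  obtain ⟨n, hn⟩ := exp_eq_exp_iff_exists_int.mp he
  rw [hn, add_sub_cancel_left, norm_mul, norm_mul, norm_mul, norm_I, norm_real, Real.norm_eq_abs,
    abs_of_pos Real.pi_pos] at ht
  have hn0 : n = 0 := by
    by_contra h0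
    have h1 : (1 : ℝ) ≤ ‖(n : ℂ)‖ := by
      rw [norm_intCast]
      exact_mod_cast Int.one_le_abs h0
    have h2 : ‖(2 : ℂ)‖ = 2 := by simp
    rw [h2] at ht
    nlinarith [Real.pi_pos]
  rw [hn, hn0]
  simp

end Log

/-! ### Monodromy over a punctured plane as a combination of winding numbers -/

section Splitting

variable {E A ι : Type*} [TopologicalSpace E] [AddCommGroup A] [AddAction A E]
  [Fintype ι] {β : ι → ℂ}

/-- Over `V` the covering `q` is the one obtained from the logarithms of the functions `z - β j`
and the elements `α j` of `A`: there is a locally constant function on the pairs consisting of a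
point of `E` and a choice of logarithms that transforms accordingly. -/
def Splits (q : E → ↥(Set.range β)ᶜ) (V : Set ℂ) (α : ι → A) : Prop :=
  ∃ g : E → (ι → ℂ) → A, ∀ e ζ, (q e : ℂ) ∈ V → IsLog β (q e) ζ →
    (∀ a : A, g (a +ᵥ e) ζ = a + g e ζ) ∧
    (∀ m : ι → ℤ, g e (fun j ↦ ζ j + m j * (2 * Real.pi * I)) = g e ζ - ∑ j, m j • α j) ∧
    ∀ᶠ p : E × (ι → ℂ) in 𝓝 (e, ζ), IsLog β (q p.1) p.2 → g p.1 p.2 = g e ζ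

variable {q : E → ↥(Set.range β)ᶜ} (hq : IsAddQuotientCoveringMap q A) {V : Set ℂ}

omit [Fintype ι] in
include hq in
theorem exists_lift {T : Type*} [TopologicalSpace T] [SimplyConnectedSpace T]
    [LocallyPathConnectedSpace T] (f : T → ℂ) (hf : Continuous f)
    (h : ∀ t, f t ∈ (Set.range β)ᶜ) : ∃ σ : T → E, Continuous σ ∧ ∀ t, (q (σ t) : ℂ) = f t := by
  obtain ⟨t₀⟩ : Nonempty T := inferInstance
  obtain ⟨e₀, he₀⟩ := hq.surjective ⟨f t₀, h t₀⟩
  obtain ⟨F, ⟨-, hF⟩, -⟩ := hq.isCoveringMap.existsUnique_continuousMap_lifts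
    ⟨fun t ↦ ⟨f t, h t⟩, hf.subtype_mk _⟩ t₀ e₀ he₀
  exact ⟨F, F.continuous, fun t ↦ congrArg Subtype.val (congrFun hF t)⟩

omit [Fintype ι] in
theorem exists_log_of_convex (hV : Convex ℝ V) (hVo : IsOpen V) {b : ℂ} (hb : b ∉ V) :
    ∃ L : ℂ → ℂ, ContinuousOn L V ∧ ∀ z ∈ V, exp (L z) = z - b := by
  rcases V.eq_empty_or_nonempty with rfl | hne
  · exact ⟨0, continuousOn_const, by simp⟩
  have hs : IsSimplyConnected V := by
    have := hV.contractibleSpace hne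
    exact (inferInstance : SimplyConnectedSpace V)
  obtain ⟨f, hf, hf'⟩ := exists_continuousOn_eqOn_exp_comp hs hVo (g := fun z ↦ z - b)
    (by fun_prop) (by rintro ⟨z, hz, h⟩; exact hb (sub_eq_zero.mp h ▸ hz))
  exact ⟨f, hf, hf'⟩

/-- Near a convex open set that does not contain `b`, the logarithms of `z - b` are numbered by
the integers. -/
theorem exists_logIndex (hV : Convex ℝ V) (hVo : IsOpen V) {b : ℂ} (hb : b ∉ V) :
    ∃ k : ℂ → ℂ → ℤ, ∀ z ∈ V, ∀ w, exp w = z - b →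
      (∀ m : ℤ, k z (w + m * (2 * Real.pi * I)) = k z w + m) ∧
      ∀ᶠ p : ℂ × ℂ in 𝓝 (z, w), exp p.2 = p.1 - b → k p.1 p.2 = k z w := by
  obtain ⟨L, hL, hL'⟩ := exists_log_of_convex hV hVo hb
  have hk : ∀ z w, ∃ n : ℤ, z ∈ V → exp w = z - b → w = L z + n * (2 * Real.pi * I) := by
    intro z w
    by_cases h : z ∈ V ∧ exp w = z - b
    · obtain ⟨n, hn⟩ := exp_eq_exp_iff_exists_int.mp (h.2.trans (hL' z h.1).symm)
      exact ⟨n, fun _ _ ↦ hn⟩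
    · exact ⟨0, fun h1 h2 ↦ (h ⟨h1, h2⟩).elim⟩
  choose k hk using hk
  refine ⟨k, fun z hz w hw ↦ ⟨fun m ↦ ?_, ?_⟩⟩
  · have h1 := hk z (w + m * (2 * Real.pi * I)) hz (by
      rw [exp_add, exp_int_mul_two_pi_mul_I, mul_one, hw])
    have h2 := hk z w hz hw
    apply two_pi_I_int_injective
    push_cast
    linear_combination h2 - h1
  · have hLc : ContinuousAt L z := hL.continuousAt (hVo.mem_nhds hz)
    have h1 : Tendsto (fun p : ℂ × ℂ ↦ L p.1 + k z w * (2 * Real.pi * I))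
        (𝓝 (z, w) ⊓ 𝓟 {p | exp p.2 = p.1 - b}) (𝓝 w) := by
      refine Tendsto.mono_left ?_ inf_le_left
      have : Tendsto (fun p : ℂ × ℂ ↦ L p.1) (𝓝 (z, w)) (𝓝 (L z)) :=
        hLc.tendsto.comp (continuous_fst.tendsto (z, w))
      have h3 := this.add_const (k z w * (2 * Real.pi * I))
      rwa [← hk z w hz hw] at h3
    have h2 : Tendsto (fun p : ℂ × ℂ ↦ p.2)
        (𝓝 (z, w) ⊓ 𝓟 {p | exp p.2 = p.1 - b}) (𝓝 w) :=
      (continuous_snd.tendsto (z, w)).mono_left inf_le_left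
    have hVe : ∀ᶠ p : ℂ × ℂ in 𝓝 (z, w), p.1 ∈ V :=
      (continuous_fst.tendsto (z, w)).eventually (hVo.mem_nhds hz)
    have h4 : ∀ᶠ p : ℂ × ℂ in 𝓝 (z, w) ⊓ 𝓟 {p | exp p.2 = p.1 - b},
        exp (L p.1 + k z w * (2 * Real.pi * I)) = exp p.2 := by
      rw [eventually_inf_principal]
      filter_upwards [hVe] with p hp hp2
      rw [exp_add, exp_int_mul_two_pi_mul_I, mul_one, hL' _ hp, hp2]
    have h5 := eventually_eq_of_exp_eq h1 h2 h4
    rw [eventually_inf_principal] at h5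
    filter_upwards [h5, hVe] with p hp hpV hpe
    apply two_pi_I_int_injective
    have h6 := hk p.1 p.2 hpV hpe
    linear_combination -hp hpe - h6

end Splitting

section Splitting

variable {E A ι : Type*} [TopologicalSpace E] [AddCommGroup A] [AddAction A E]
  [Fintype ι] {β : ι → ℂ}

variable {q : E → ↥(Set.range β)ᶜ} (hq : IsAddQuotientCoveringMap q A) {V : Set ℂ}

include hq

/-- Changing the elements `α j` for which `β j` lies outside `V`. -/
theorem Splits.congr (hV : Convex ℝ V) (hVo : IsOpen V) {α α' : ι → A} (h : Splits q V α)
    (hα : ∀ j, β j ∈ V → α j = α' j) : Splits q V α' := by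
  have hk : ∀ j, ∃ k : ℂ → ℂ → ℤ, β j ∉ V → ∀ z ∈ V, ∀ w, exp w = z - β j →
      (∀ m : ℤ, k z (w + m * (2 * Real.pi * I)) = k z w + m) ∧
      ∀ᶠ p : ℂ × ℂ in 𝓝 (z, w), exp p.2 = p.1 - β j → k p.1 p.2 = k z w := by
    intro j
    by_cases hj : β j ∈ V
    · exact ⟨fun _ _ ↦ 0, fun h ↦ (h hj).elim⟩
    · obtain ⟨k, hk⟩ := exists_logIndex hV hVo hj
      exact ⟨k, fun _ ↦ hk⟩
  choose k hk using hk
  obtain ⟨g, hg⟩ := h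
  -- The index of the `j`-th logarithm grows by `m j` under a shift by `m j` periods, so the
  -- correction turns the coefficient `α j` into `α' j`. For `β j` in `V` no index exists, but the
  -- difference is zero.
  refine ⟨fun e ζ ↦ g e ζ + ∑ j, k j (q e) (ζ j) • (α j - α' j), fun e ζ he hζ ↦ ?_⟩
  obtain ⟨h1, h2, h3⟩ := hg e ζ he hζ
  refine ⟨fun a ↦ ?_, fun m ↦ ?_, ?_⟩
  · have hqa : q (a +ᵥ e) = q e := hq.map_vadd a
    simp only [h1, hqa, add_assoc]
  · have h4 : ∀ j, k j (q e) (ζ j + m j * (2 * Real.pi * I)) • (α j - α' j) =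
        k j (q e) (ζ j) • (α j - α' j) + (m j • α j - m j • α' j) := by
      intro j
      by_cases hj : β j ∈ V
      · simp [hα j hj]
      · rw [(hk j hj _ he _ (hζ j)).1, add_smul, smul_sub (m j)]
    simp only [h2, h4, Finset.sum_add_distrib, Finset.sum_sub_distrib]
    abel
  · have h5 : ∀ᶠ p : E × (ι → ℂ) in 𝓝 (e, ζ), ∀ j, IsLog β (q p.1) p.2 →
        k j (q p.1) (p.2 j) • (α j - α' j) = k j (q e) (ζ j) • (α j - α' j) := by
      rw [eventually_all]
      intro j
      by_cases hj : β j ∈ V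
      · simp [hα j hj]
      · have hc : Continuous fun p : E × (ι → ℂ) ↦ ((q p.1 : ℂ), p.2 j) := by
          have := hq.continuous
          fun_prop
        filter_upwards [(hc.tendsto (e, ζ)).eventually (hk j hj _ he _ (hζ j)).2] with p hp hl
        rw [hp (hl j)]
    filter_upwards [h3, h5] with p hp hp' hl
    rw [hp hl, Finset.sum_congr rfl fun j _ ↦ hp' j hl]

/-- Over a convex open set without punctures the covering is trivial. -/
theorem splits_of_forall_notMem (hV : Convex ℝ V) (hVo : IsOpen V) (h : ∀ j, β j ∉ V) :
    Splits q V (0 : ι → A) := by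
  rcases V.eq_empty_or_nonempty with rfl | hne
  · exact ⟨0, by simp⟩
  have := hV.contractibleSpace hne
  have := hVo.locallyPathConnectedSpace
  obtain ⟨σ, hσ, hσq⟩ := exists_lift hq (T := V) Subtype.val continuous_subtype_val (by
    rintro ⟨z, hz⟩ ⟨j, rfl⟩
    exact h j hz)
  have hσ' : ∀ t, ∀ e, (q e : ℂ) = t.1 → q (σ t) = q e := fun t e ht ↦
    Subtype.ext ((hσq t).trans ht.symm)
  classical
  refine ⟨fun e ζ ↦ if h : (q e : ℂ) ∈ V then fiberDiff A (σ ⟨q e, h⟩) e else 0,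
    fun e ζ he hζ ↦ ?_⟩
  refine ⟨fun a ↦ ?_, fun m ↦ by simp, ?_⟩
  · have hqa : q (a +ᵥ e) = q e := hq.map_vadd a
    have he' : (q (a +ᵥ e) : ℂ) ∈ V := hqa ▸ he
    beta_reduce
    rw [dif_pos he, dif_pos he']
    apply fiberDiff_eq hq
    simp only [hqa]
    rw [add_vadd, fiberDiff_vadd hq (hσ' _ _ rfl)]
  · have hc : Tendsto (fun p : E × (ι → ℂ) ↦ (q p.1 : ℂ)) (𝓝 (e, ζ)) (𝓝 (q e)) := by
      have := hq.continuous
      exact Continuous.tendsto (by fun_prop : Continuous fun p : E × (ι → ℂ) ↦ (q p.1 : ℂ)) (e, ζ)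
    have hev : ∀ᶠ p : E × (ι → ℂ) in 𝓝 (e, ζ), (q p.1 : ℂ) ∈ V := hc (hVo.mem_nhds he)
    obtain ⟨σ', hσ'e⟩ : ∃ σ' : ℂ → E, ∀ z (hz : z ∈ V), σ' z = σ ⟨z, hz⟩ :=
      ⟨fun z ↦ if hz : z ∈ V then σ ⟨z, hz⟩ else e, fun z hz ↦ dif_pos hz⟩
    have hσc : ContinuousAt σ' (q e) := by
      have : ContinuousOn σ' V := by
        rw [continuousOn_iff_continuous_domRestrict]
        exact hσ.congr fun z ↦ (hσ'e z.1 z.2).symm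
      exact this.continuousAt (hVo.mem_nhds he)
    have h6 := eventually_fiberDiff_eq hq (hσc.tendsto.comp hc) (continuous_fst.tendsto (e, ζ))
      (by rw [hσ'e _ he]; exact hσ' _ _ rfl) (by
        filter_upwards [hev] with p hp
        simp only [Function.comp]
        rw [hσ'e _ hp]
        exact hσ' _ _ rfl)
    filter_upwards [h6, hev] with p hp hpV _
    rw [dif_pos he, dif_pos hpV, ← hσ'e, ← hσ'e]
    exact hp

-- The set is first pushed to the left into a half-plane that it contains; the half-plane is then
-- contracted along straight lines. It is applied to the preimage of a punctured convex set under `w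
-- ↦ exp w + b`.
omit hq in
omit [TopologicalSpace E] [AddCommGroup A] [AddAction A E] [Fintype ι] in
theorem contractibleSpace_exp_preimage {W : Set ℂ} {u₀ : ℝ} (h₀ : {w : ℂ | w.re ≤ u₀} ⊆ W)
    (hW : ∀ w ∈ W, ∀ t : ℝ, 0 ≤ t → w - t ∈ W) : ContractibleSpace W := by
  rw [contractible_iff_id_nullhomotopic]
  let H₁ : C(unitInterval × W, W) := ⟨fun p ↦ ⟨p.2.1 - ((p.1 * max (p.2.1.re - u₀) 0 : ℝ) : ℂ),
    hW _ p.2.2 _ (mul_nonneg p.1.2.1 (le_max_right _ _))⟩, by fun_prop⟩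
  have hr : ∀ w : W, (H₁ (1, w)).1.re ≤ u₀ := by
    intro w
    simp only [H₁, ContinuousMap.coe_mk, sub_re, ofReal_re, Set.Icc.coe_one, one_mul]
    linarith [le_max_left (w.1.re - u₀) 0]
  let H₂ : C(unitInterval × W, W) :=
    ⟨fun p ↦ ⟨((1 - p.1 : ℝ) : ℂ) * (H₁ (1, p.2)).1 + ((p.1 * u₀ : ℝ) : ℂ),
    h₀ (by
      have h1 := hr p.2
      have h2 := p.1.2.1
      have h3 := p.1.2.2
      simp only [Set.mem_ofPred_eq, add_re, re_ofReal_mul, ofReal_re]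
      nlinarith)⟩, by fun_prop⟩
  have hu : (u₀ : ℂ) ∈ W := h₀ (by simp)
  refine ⟨⟨u₀, hu⟩, ?_⟩
  have e₁ : (ContinuousMap.id W).Homotopic ⟨fun w ↦ H₁ (1, w), by fun_prop⟩ :=
    ⟨⟨H₁, fun w ↦ Subtype.ext (by simp [H₁]), fun w ↦ rfl⟩⟩
  have e₂ : ContinuousMap.Homotopic ⟨fun w ↦ H₁ (1, w), by fun_prop⟩
      (ContinuousMap.const W (⟨u₀, hu⟩ : W)) :=
    ⟨⟨H₂, fun w ↦ Subtype.ext (by simp [H₂]), fun w ↦ Subtype.ext (by simp [H₂])⟩⟩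
  exact e₁.trans e₂

/-- Over a convex open set with one puncture. -/
theorem exists_splits_of_unique (hV : Convex ℝ V) (hVo : IsOpen V) (i : ι) (hi : β i ∈ V)
    (h : ∀ j, β j ∈ V → β j = β i) : ∃ α : ι → A, Splits q V α := by
  -- `W` is the logarithmic cover of `V` without `β i`. It is contractible, so the covering has a
  -- section `σ` over it, and translation by `2πi` changes `σ` by a constant `a`.
  let W : Set ℂ := {w | exp w + β i ∈ V}
  have hWo : IsOpen W := hVo.preimage (by fun_prop)
  obtain ⟨r, hr, hrV⟩ := Metric.isOpen_iff.mp hVo _ hi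
  have h₀ : {w : ℂ | w.re ≤ Real.log (r / 2)} ⊆ W := by
    intro w hw
    apply hrV
    rw [Metric.mem_ball, dist_eq_norm, add_sub_cancel_right, norm_exp]
    calc Real.exp w.re ≤ Real.exp (Real.log (r / 2)) := Real.exp_le_exp.mpr hw
      _ = r / 2 := Real.exp_log (by positivity)
      _ < r := by linarith
  have hWs : ∀ w ∈ W, ∀ t : ℝ, 0 ≤ t → w - t ∈ W := by
    intro w hw t ht
    have h1 : exp (w - t) + β i = (1 - Real.exp (-t)) • β i + Real.exp (-t) • (exp w + β i) := by
      rw [sub_eq_add_neg, exp_add, real_smul, real_smul]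
      push_cast
      ring
    show exp (w - t) + β i ∈ V
    rw [h1]
    exact hV hi hw (by simpa using ht) (Real.exp_pos _).le (by ring)
  have := contractibleSpace_exp_preimage h₀ hWs
  have := hWo.locallyPathConnectedSpace
  obtain ⟨σ, hσ, hσq⟩ := exists_lift hq (T := W) (fun w ↦ exp w.1 + β i) (by fun_prop) (by
    rintro ⟨w, hw⟩ ⟨j, hj⟩
    have h2 : exp w = 0 := by
      have := h j (hj ▸ hw)
      simp only at hj
      linear_combination this - hj
    exact exp_ne_zero _ h2)
  have hperiod : ∀ m : ℤ, ∀ w ∈ W, w + m * (2 * Real.pi * I) ∈ W := by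
    intro m w hw
    show exp _ + β i ∈ V
    rw [exp_add, exp_int_mul_two_pi_mul_I, mul_one]
    exact hw
  let τ : ℤ → W → W := fun m w ↦ ⟨w.1 + m * (2 * Real.pi * I), hperiod m w.1 w.2⟩
  have hτ : ∀ m, Continuous (τ m) := fun m ↦ by fun_prop
  have hτq : ∀ m w, q (σ w) = q (σ (τ m w)) := by
    intro m w
    apply Subtype.ext
    rw [hσq, hσq]
    simp only [τ]
    rw [exp_add, exp_int_mul_two_pi_mul_I, mul_one]
  obtain ⟨w₀⟩ : Nonempty W := inferInstance
  let a : A := fiberDiff A (σ w₀) (σ (τ 1 w₀))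
  have ha : ∀ w, a +ᵥ σ w = σ (τ 1 w) := by
    intro w
    have := fiberDiff_eq_of_isPreconnected hq hσ (hσ.comp (hτ 1)) (hτq 1) w₀ w
    simp only [Function.comp] at this
    simp only [a]
    rw [this, fiberDiff_vadd hq (hτq 1 w)]
  have hm : ∀ m : ℤ, ∀ w, (m • a) +ᵥ σ w = σ (τ m w) := by
    intro m
    induction m with
    | zero => intro w; simp [τ]
    | succ n ih =>
      intro w
      rw [add_smul, one_smul, add_comm, add_vadd, ih, ha]
      congr 1
      apply Subtype.ext
      simp only [τ]
      push_cast
      ring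
    | pred n ih =>
      intro w
      have h3 := ha (τ (-n - 1) w)
      have h4 : τ 1 (τ (-n - 1) w) = τ (-n) w := by
        apply Subtype.ext
        simp only [τ]
        push_cast
        ring
      rw [h4, ← ih] at h3
      rw [sub_smul, one_smul, sub_eq_neg_add, add_vadd, ← h3, neg_vadd_vadd]
  classical
  -- Since `β` need not be injective, several indices may name the same puncture; the whole period
  -- is assigned to `i`. The value 0 off `W` is never used.
  refine ⟨Pi.single i a, fun e ζ ↦ if h : ζ i ∈ W then fiberDiff A (σ ⟨ζ i, h⟩) e else 0,
    fun e ζ he hζ ↦ ?_⟩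
  have hW : ∀ p : E × (ι → ℂ), IsLog β (q p.1) p.2 → (q p.1 : ℂ) ∈ V → p.2 i ∈ W := by
    intro p hp hpV
    show exp _ + β i ∈ V
    rw [hp i, sub_add_cancel]
    exact hpV
  have hWq : ∀ p : E × (ι → ℂ), ∀ hp : p.2 i ∈ W, IsLog β (q p.1) p.2 →
      q (σ ⟨p.2 i, hp⟩) = q p.1 := by
    intro p hp hl
    apply Subtype.ext
    rw [hσq, hl i, sub_add_cancel]
  have hζW : ζ i ∈ W := hW (e, ζ) hζ he
  refine ⟨fun b ↦ ?_, fun m ↦ ?_, ?_⟩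
  · beta_reduce
    rw [dif_pos hζW, dif_pos hζW]
    apply fiberDiff_eq hq
    rw [add_vadd, fiberDiff_vadd hq (hWq (e, ζ) hζW hζ)]
  · beta_reduce
    rw [dif_pos hζW, dif_pos (hperiod (m i) _ hζW)]
    apply fiberDiff_eq hq
    have h5 := hm (m i) ⟨ζ i, hζW⟩
    simp only [τ] at h5
    rw [← h5]
    have h6 : ∑ j, m j • (Pi.single i a : ι → A) j = m i • a := by
      rw [Finset.sum_eq_single i]
      · simp
      · intro j _ hj
        simp [hj]
      · simp
    rw [h6, vadd_vadd, sub_add_cancel, fiberDiff_vadd hq (hWq (e, ζ) hζW hζ)]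
  · obtain ⟨σ', hσ'e⟩ : ∃ σ' : ℂ → E, ∀ z (hz : z ∈ W), σ' z = σ ⟨z, hz⟩ :=
      ⟨fun z ↦ if hz : z ∈ W then σ ⟨z, hz⟩ else e, fun z hz ↦ dif_pos hz⟩
    have hσc : ContinuousAt σ' (ζ i) := by
      have : ContinuousOn σ' W := by
        rw [continuousOn_iff_continuous_domRestrict]
        exact hσ.congr fun z ↦ (hσ'e z.1 z.2).symm
      exact this.continuousAt (hWo.mem_nhds hζW)
    have hc : Tendsto (fun p : E × (ι → ℂ) ↦ p.2 i) (𝓝 (e, ζ)) (𝓝 (ζ i)) :=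
      Continuous.tendsto (by fun_prop : Continuous fun p : E × (ι → ℂ) ↦ p.2 i) (e, ζ)
    have hev : ∀ᶠ p : E × (ι → ℂ) in 𝓝 (e, ζ), p.2 i ∈ W := hc (hWo.mem_nhds hζW)
    have h6 := eventually_fiberDiff_eq hq (l := 𝓝 (e, ζ) ⊓ 𝓟 {p | IsLog β (q p.1) p.2})
      ((hσc.tendsto.comp hc).mono_left inf_le_left)
      ((continuous_fst.tendsto (e, ζ)).mono_left inf_le_left)
      (by rw [hσ'e _ hζW]; exact hWq (e, ζ) hζW hζ) (by
        rw [eventually_inf_principal]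
        filter_upwards [hev] with p hp hl
        simp only [Function.comp]
        rw [hσ'e _ hp]
        exact hWq p hp hl)
    rw [eventually_inf_principal] at h6
    filter_upwards [h6, hev] with p hp hpV hl
    rw [dif_pos hζW, dif_pos hpV, ← hσ'e, ← hσ'e]
    exact hp hl

end Splitting

section Splitting

variable {E A ι : Type*} [TopologicalSpace E] [AddCommGroup A] [AddAction A E]
  [Fintype ι] {β : ι → ℂ}

variable {q : E → ↥(Set.range β)ᶜ} (hq : IsAddQuotientCoveringMap q A) {V : Set ℂ}

include hq

/-- Two splittings over a connected set without punctures differ by a constant. -/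
theorem exists_sub_eq_const {V₁ V₂ : Set ℂ} (hpre : IsPreconnected (V₁ ∩ V₂))
    (hX : ∀ j, β j ∉ V₁ ∩ V₂) {α : ι → A} {g₁ g₂ : E → (ι → ℂ) → A}
    (h₁ : ∀ e ζ, (q e : ℂ) ∈ V₁ → IsLog β (q e) ζ →
      (∀ a : A, g₁ (a +ᵥ e) ζ = a + g₁ e ζ) ∧
      (∀ m : ι → ℤ, g₁ e (fun j ↦ ζ j + m j * (2 * Real.pi * I)) = g₁ e ζ - ∑ j, m j • α j) ∧
      ∀ᶠ p : E × (ι → ℂ) in 𝓝 (e, ζ), IsLog β (q p.1) p.2 → g₁ p.1 p.2 = g₁ e ζ)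
    (h₂ : ∀ e ζ, (q e : ℂ) ∈ V₂ → IsLog β (q e) ζ →
      (∀ a : A, g₂ (a +ᵥ e) ζ = a + g₂ e ζ) ∧
      (∀ m : ι → ℤ, g₂ e (fun j ↦ ζ j + m j * (2 * Real.pi * I)) = g₂ e ζ - ∑ j, m j • α j) ∧
      ∀ᶠ p : E × (ι → ℂ) in 𝓝 (e, ζ), IsLog β (q p.1) p.2 → g₂ p.1 p.2 = g₂ e ζ) :
    ∃ D : A, ∀ e ζ, (q e : ℂ) ∈ V₁ ∩ V₂ → IsLog β (q e) ζ → g₁ e ζ = g₂ e ζ + D := by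
  -- The choices `s` of a lift and `l` of logarithms are not continuous. The difference `g₁ - g₂`
  -- does not depend on them, because translations by `A` and changes of logarithms affect both
  -- terms alike.
  choose s hs using hq.surjective
  choose l hl using fun z : ↥(Set.range β)ᶜ ↦ exists_isLog (β := β) z.2
  have hinv : ∀ e ζ, (q e : ℂ) ∈ V₁ ∩ V₂ → IsLog β (q e) ζ →
      g₁ e ζ - g₂ e ζ = g₁ (s (q e)) (l (q e)) - g₂ (s (q e)) (l (q e)) := by
    intro e ζ he hζ
    obtain ⟨a, ha⟩ := exists_vadd_eq hq (hs (q e))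
    obtain ⟨m, hm⟩ := (hl (q e)).exists_int hζ
    have hqs : (q (s (q e)) : ℂ) = q e := by rw [hs]
    have hls : IsLog β (q (s (q e))) (l (q e)) := hqs ▸ hl (q e)
    have hls' : IsLog β (q (s (q e))) ζ := hqs ▸ hζ
    have hV₁ : (q (s (q e)) : ℂ) ∈ V₁ := hqs ▸ he.1
    have hV₂ : (q (s (q e)) : ℂ) ∈ V₂ := hqs ▸ he.2
    have e₁ : g₁ e ζ = a + g₁ (s (q e)) ζ := by
      conv_lhs => rw [← ha]
      exact (h₁ _ _ hV₁ hls').1 a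
    have e₂ : g₂ e ζ = a + g₂ (s (q e)) ζ := by
      conv_lhs => rw [← ha]
      exact (h₂ _ _ hV₂ hls').1 a
    have e₃ := (h₁ _ _ hV₁ hls).2.1 m
    have e₄ := (h₂ _ _ hV₂ hls).2.1 m
    rw [← hm] at e₃ e₄
    rw [e₁, e₂, e₃, e₄]
    abel
  have : PreconnectedSpace ↥(V₁ ∩ V₂) := isPreconnected_iff_preconnectedSpace.mp hpre
  have hmem : ∀ t : ↥(V₁ ∩ V₂), t.1 ∈ (Set.range β)ᶜ := by
    rintro ⟨t, ht⟩ ⟨j, rfl⟩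
    exact hX j ht
  let ν : ↥(V₁ ∩ V₂) → ↥(Set.range β)ᶜ := fun t ↦ ⟨t.1, hmem t⟩
  have hν : Continuous ν := by fun_prop
  have hloc : IsLocallyConstant fun t : ↥(V₁ ∩ V₂) ↦
      g₁ (s (ν t)) (l (ν t)) - g₂ (s (ν t)) (l (ν t)) := by
    rw [IsLocallyConstant.iff_eventually_eq]
    intro t₀
    obtain ⟨φ, hφ, hφq⟩ := hq.isCoveringMap.isLocalHomeomorph (s (ν t₀))
    have hφt : ν t₀ ∈ φ.target := by
      have := φ.map_source hφ
      rwa [← hφq, hs] at this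
    have hφs : φ.symm (ν t₀) = s (ν t₀) := by
      have := φ.left_inv hφ
      rwa [← hφq, hs] at this
    have hc₁ : Tendsto (fun t ↦ φ.symm (ν t)) (𝓝 t₀) (𝓝 (s (ν t₀))) := by
      have := (φ.continuousAt_symm hφt).tendsto.comp (hν.tendsto t₀)
      rwa [hφs] at this
    -- A choice of logarithms continuous at `t₀`: the quotient is near 1, away from the cut of the
    -- principal branch.
    let ζ : ↥(V₁ ∩ V₂) → ι → ℂ := fun t j ↦ l (ν t₀) j + log ((t.1 - β j) / (t₀.1 - β j))
    have hne : ∀ (t : ↥(V₁ ∩ V₂)) j, t.1 - β j ≠ 0 := fun t j h ↦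
      hmem t ⟨j, (sub_eq_zero.mp h).symm⟩
    have hζ₀ : ζ t₀ = l (ν t₀) := by
      funext j
      simp [ζ, div_self (hne t₀ j)]
    have hc₂ : Tendsto ζ (𝓝 t₀) (𝓝 (l (ν t₀))) := by
      rw [← hζ₀]
      refine tendsto_pi_nhds.mpr fun j ↦ tendsto_const_nhds.add ?_
      refine Tendsto.clog (Continuous.tendsto (by fun_prop) t₀) ?_
      rw [div_self (hne t₀ j)]
      exact one_mem_slitPlane
    have hζ : ∀ t, IsLog β (ν t) (ζ t) := by
      intro t j
      simp only [ζ]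
      rw [exp_add, hl (ν t₀) j, exp_log (div_ne_zero (hne t j) (hne t₀ j)),
        mul_div_cancel₀ _ (hne t₀ j)]
    have hqe : (q (s (ν t₀)) : ℂ) = ν t₀ := by rw [hs]
    have hl₀ : IsLog β (q (s (ν t₀))) (l (ν t₀)) := hqe ▸ hl _
    have k₁ := (hc₁.prodMk_nhds hc₂).eventually
      (h₁ _ _ (hqe ▸ t₀.2.1) hl₀).2.2
    have k₂ := (hc₁.prodMk_nhds hc₂).eventually
      (h₂ _ _ (hqe ▸ t₀.2.2) hl₀).2.2
    have hφe : ∀ᶠ t in 𝓝 t₀, ν t ∈ φ.target := (hν.tendsto t₀) (φ.open_target.mem_nhds hφt)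
    filter_upwards [k₁, k₂, hφe] with t ht₁ ht₂ htφ
    have hqt : q (φ.symm (ν t)) = ν t := by
      rw [hφq]
      exact φ.right_inv htφ
    have hlt : IsLog β (q (φ.symm (ν t))) (ζ t) := by
      rw [hqt]
      exact hζ t
    have := hinv (φ.symm (ν t)) (ζ t) (by rw [hqt]; exact t.2) hlt
    rw [hqt] at this
    rw [← this, ht₁ hlt, ht₂ hlt]
  by_cases hne : Nonempty ↥(V₁ ∩ V₂)
  · obtain ⟨t₀⟩ := hne
    refine ⟨g₁ (s (ν t₀)) (l (ν t₀)) - g₂ (s (ν t₀)) (l (ν t₀)), fun e ζ he hζ ↦ ?_⟩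
    rw [← hloc.apply_eq_of_preconnectedSpace ⟨q e, he⟩ t₀]
    have := hinv e ζ he hζ
    simp only [ν]
    rw [← this]
    abel
  · exact ⟨0, fun e ζ he ↦ (hne ⟨⟨_, he⟩⟩).elim⟩

/-- On the overlap the two functions differ by a constant `D`, which is absorbed into the second one
before gluing. -/
theorem Splits.union {V₁ V₂ : Set ℂ} (hV₁ : IsOpen V₁) (hV₂ : IsOpen V₂)
    (hpre : IsPreconnected (V₁ ∩ V₂)) (hX : ∀ j, β j ∉ V₁ ∩ V₂) {α : ι → A}
    (h₁ : Splits q V₁ α) (h₂ : Splits q V₂ α) : Splits q (V₁ ∪ V₂) α := by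
  obtain ⟨g₁, h₁⟩ := h₁
  obtain ⟨g₂, h₂⟩ := h₂
  obtain ⟨D, hD⟩ := exists_sub_eq_const hq hpre hX h₁ h₂
  classical
  let g : E → (ι → ℂ) → A := fun e ζ ↦ if (q e : ℂ) ∈ V₁ then g₁ e ζ else g₂ e ζ + D
  have hg₁ : ∀ e ζ, (q e : ℂ) ∈ V₁ → g e ζ = g₁ e ζ := fun e ζ he ↦ if_pos he
  have hg₂ : ∀ e ζ, (q e : ℂ) ∈ V₂ → IsLog β (q e) ζ → g e ζ = g₂ e ζ + D := by
    intro e ζ he hζ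
    by_cases he₁ : (q e : ℂ) ∈ V₁
    · rw [hg₁ e ζ he₁, hD e ζ ⟨he₁, he⟩ hζ]
    · exact if_neg he₁
  have hc : Continuous fun p : E × (ι → ℂ) ↦ (q p.1 : ℂ) := by
    have := hq.continuous
    fun_prop
  refine ⟨g, fun e ζ he hζ ↦ ?_⟩
  have hqa : ∀ a : A, q (a +ᵥ e) = q e := fun a ↦ hq.map_vadd a
  rcases he with he | he
  · obtain ⟨k₁, k₂, k₃⟩ := h₁ e ζ he hζ
    refine ⟨fun a ↦ ?_, fun m ↦ ?_, ?_⟩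
    · rw [hg₁ _ _ he, hg₁ _ _ (hqa a ▸ he), k₁]
    · rw [hg₁ _ _ he, hg₁ _ _ he, k₂]
    · have hev : ∀ᶠ p : E × (ι → ℂ) in 𝓝 (e, ζ), (q p.1 : ℂ) ∈ V₁ :=
        hc.tendsto (e, ζ) (hV₁.mem_nhds he)
      filter_upwards [k₃, hev] with p hp hpV hl
      rw [hg₁ _ _ he, hg₁ _ _ hpV, hp hl]
  · obtain ⟨k₁, k₂, k₃⟩ := h₂ e ζ he hζ
    refine ⟨fun a ↦ ?_, fun m ↦ ?_, ?_⟩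
    · rw [hg₂ _ _ he hζ, hg₂ _ _ (hqa a ▸ he) (hqa a ▸ hζ), k₁, add_assoc]
    · rw [hg₂ _ _ he hζ, hg₂ _ _ he (hζ.add_int m), k₂]
      abel
    · have hev : ∀ᶠ p : E × (ι → ℂ) in 𝓝 (e, ζ), (q p.1 : ℂ) ∈ V₂ :=
        hc.tendsto (e, ζ) (hV₂.mem_nhds he)
      filter_upwards [k₃, hev] with p hp hpV hl
      rw [hg₂ _ _ he hζ, hg₂ _ _ hpV hl, hp hl]

omit hq in
omit [TopologicalSpace E] [AddCommGroup A] [AddAction A E] in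
/-- Two distinct punctures can be separated by a strip that contains none. -/
theorem exists_strip (f : ℂ → ℝ) {i j : ι} (hij : f (β i) < f (β j)) :
    ∃ s t : ℝ, f (β i) < s ∧ s < t ∧ t < f (β j) ∧ ∀ k, f (β k) ≤ s ∨ t ≤ f (β k) := by
  classical
  let S := Finset.univ.filter fun k ↦ f (β k) < f (β j)
  obtain ⟨k, hk, hmax⟩ := S.exists_max_image (fun k ↦ f (β k)) ⟨i, by simpa [S] using hij⟩
  have hkj : f (β k) < f (β j) := by simpa [S] using hk
  have hik := hmax i (by simpa [S] using hij)
  -- With `f (β k)` the largest value below `f (β j)`, the strip is the middle third of the gap.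
  refine ⟨(2 * f (β k) + f (β j)) / 3, (f (β k) + 2 * f (β j)) / 3, by linarith, by linarith,
    by linarith, fun l ↦ ?_⟩
  by_cases hl : f (β l) < f (β j)
  · have := hmax l (by simpa [S] using hl)
    left
    linarith
  · right
    linarith

/-- Induction on the number of indices with puncture in `V`. A strip between two distinct punctures
cuts `V` into two overlapping convex pieces with fewer punctures each. `Splits.congr` makes their
coefficient families agree before `Splits.union` glues them. -/
theorem exists_splits :
    ∀ (N : ℕ) (V : Set ℂ), Convex ℝ V → IsOpen V → {j | β j ∈ V}.ncard ≤ N →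
      ∃ α : ι → A, Splits q V α := by
  intro N
  induction N with
  | zero =>
    intro V hV hVo hN
    have : {j | β j ∈ V} = ∅ := (Set.ncard_eq_zero (Set.toFinite _)).mp (by omega)
    exact ⟨0, splits_of_forall_notMem hq hV hVo fun j hj ↦
      (Set.eq_empty_iff_forall_notMem.mp this j) hj⟩
  | succ N ih =>
    intro V hV hVo hN
    by_cases hone : ∃ i, β i ∈ V
    swap
    · exact ⟨0, splits_of_forall_notMem hq hV hVo fun j hj ↦ hone ⟨j, hj⟩⟩
    obtain ⟨i, hi⟩ := hone
    by_cases htwo : ∃ j, β j ∈ V ∧ β j ≠ β i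
    swap
    · exact exists_splits_of_unique hq hV hVo i hi fun j hj ↦ by
        by_contra h
        exact htwo ⟨j, hj, h⟩
    obtain ⟨j, hj, hji⟩ := htwo
    -- The real inner product with `β j - β i`, which separates the two punctures.
    let f : ℂ →L[ℝ] ℝ := reCLM.comp (ContinuousLinearMap.mul ℝ ℂ (starRingEnd ℂ (β j - β i)))
    have hf : f (β i) < f (β j) := by
      rw [← sub_pos, ← map_sub]
      have : f (β j - β i) = normSq (β j - β i) := by
        simp [f, normSq_apply]
        ring
      rw [this]
      exact normSq_pos.mpr (sub_ne_zero.mpr hji)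
    obtain ⟨s, t, his, hst, htj, hstrip⟩ := exists_strip f hf
    have c₁ : Convex ℝ (V ∩ {z | f z < t}) :=
      hV.inter (convex_halfSpace_lt f.toLinearMap.isLinear t)
    have c₂ : Convex ℝ (V ∩ {z | s < f z}) :=
      hV.inter (convex_halfSpace_gt f.toLinearMap.isLinear s)
    have o₁ : IsOpen (V ∩ {z | f z < t}) := hVo.inter (isOpen_lt f.continuous continuous_const)
    have o₂ : IsOpen (V ∩ {z | s < f z}) := hVo.inter (isOpen_lt continuous_const f.continuous)
    have n₁ : {k | β k ∈ V ∩ {z | f z < t}}.ncard < {k | β k ∈ V}.ncard := by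
      refine Set.ncard_lt_ncard ⟨fun k hk ↦ hk.1, fun h ↦ ?_⟩ (Set.toFinite _)
      have : f (β j) < t := (h (show j ∈ {k | β k ∈ V} from hj)).2
      linarith
    have n₂ : {k | β k ∈ V ∩ {z | s < f z}}.ncard < {k | β k ∈ V}.ncard := by
      refine Set.ncard_lt_ncard ⟨fun k hk ↦ hk.1, fun h ↦ ?_⟩ (Set.toFinite _)
      have : s < f (β i) := (h (show i ∈ {k | β k ∈ V} from hi)).2
      linarith
    obtain ⟨α₁, h₁⟩ := ih _ c₁ o₁ (by omega)
    obtain ⟨α₂, h₂⟩ := ih _ c₂ o₂ (by omega)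
    have hno : ∀ k, β k ∉ (V ∩ {z | f z < t}) ∩ (V ∩ {z | s < f z}) := by
      rintro k ⟨⟨-, hk₁⟩, -, hk₂⟩
      simp only [Set.mem_ofPred_eq] at hk₁ hk₂
      rcases hstrip k with h | h <;> linarith
    classical
    refine ⟨fun k ↦ if β k ∈ V ∩ {z | f z < t} then α₁ k else α₂ k, ?_⟩
    have hun : V = (V ∩ {z | f z < t}) ∪ (V ∩ {z | s < f z}) := by
      ext z
      constructor
      · intro hz
        by_cases hzt : f z < t
        · exact Or.inl ⟨hz, hzt⟩
        · exact Or.inr ⟨hz, lt_of_lt_of_le hst (not_lt.mp hzt)⟩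
      · rintro (h | h) <;> exact h.1
    conv_lhs => rw [hun]
    refine Splits.union hq o₁ o₂ (c₁.inter c₂).isPreconnected hno
      (h₁.congr hq c₁ o₁ fun k hk ↦ (if_pos hk).symm)
      (h₂.congr hq c₂ o₂ fun k hk ↦ (if_neg fun hk' ↦ hno k ⟨hk', hk⟩).symm)

/-- The monodromy of an abelian covering of a punctured plane is a linear combination of winding
numbers. -/
theorem exists_monodromy_eq_sum_winding :
    ∃ α : ι → A, ∀ (e : C(unitInterval, E)) (ζ : ι → C(unitInterval, ℂ)) (m : ι → ℤ),
      (∀ j t, exp (ζ j t) = q (e t) - β j) → (∀ j, ζ j 1 = ζ j 0 + m j * (2 * Real.pi * I)) →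
      q (e 0) = q (e 1) → (∑ j, m j • α j) +ᵥ e 0 = e 1 := by
  obtain ⟨α, g, hg⟩ := exists_splits hq _ Set.univ convex_univ isOpen_univ le_rfl
  refine ⟨α, fun e ζ m hζ hm h01 ↦ ?_⟩
  have hl : ∀ t, IsLog β (q (e t)) fun j ↦ ζ j t := fun t j ↦ hζ j t
  have hloc : IsLocallyConstant fun t ↦ g (e t) fun j ↦ ζ j t := by
    rw [IsLocallyConstant.iff_eventually_eq]
    intro t
    have hc : Continuous fun t ↦ (e t, fun j ↦ ζ j t) := by fun_prop
    filter_upwards [(hc.tendsto t).eventually (hg _ _ trivial (hl t)).2.2] with t' ht'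
    exact ht' (hl t')
  -- The function `g` is constant along the path. Comparing its ends, the displacement `a`
  -- contributes `+a` and the change of logarithms contributes `-∑ j, m j • α j`, so these cancel.
  have hconst := hloc.apply_eq_of_preconnectedSpace 1 0
  obtain ⟨a, ha⟩ := exists_vadd_eq hq h01
  have e₁ := (hg _ _ trivial (hl 0)).2.1 m
  have hl' : IsLog β (q (e 0)) fun j ↦ ζ j 1 := h01 ▸ hl 1
  have e₂ := (hg _ _ trivial hl').1 a
  rw [ha, hconst, funext hm, e₁] at e₂
  have : ∑ j, m j • α j = a := by
    have h3 : a - ∑ j, m j • α j = 0 := by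
      have := congrArg (fun x ↦ x - g (e 0) fun j ↦ ζ j 0) e₂
      simp only [sub_self] at this
      rw [this]
      abel
    exact (sub_eq_zero.mp h3).symm
  rw [this, ha]

end Splitting

/-! ### Winding numbers of closed curves -/

instance contractibleSpace_unitInterval : ContractibleSpace unitInterval :=
  (convex_Icc (0 : ℝ) 1).contractibleSpace ⟨0, by simp⟩

instance locallyPathConnectedSpace_unitInterval : LocallyPathConnectedSpace unitInterval :=
  (convex_Icc (0 : ℝ) 1).locallyPathConnectedSpace

/-- The closed curve `f` in `ℂ \ {0}` runs `m` times around the origin. -/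
def HasWinding (f : unitInterval → ℂ) (m : ℤ) : Prop :=
  ∃ ζ : C(unitInterval, ℂ), (∀ t, exp (ζ t) = f t) ∧ ζ 1 = ζ 0 + m * (2 * Real.pi * I)

theorem exists_continuous_log {T : Type*} [TopologicalSpace T] [SimplyConnectedSpace T]
    [LocallyPathConnectedSpace T] {f : T → ℂ} (hf : Continuous f) (h : ∀ t, f t ≠ 0) :
    ∃ ζ : C(T, ℂ), ∀ t, exp (ζ t) = f t := by
  obtain ⟨t₀⟩ : Nonempty T := inferInstance
  obtain ⟨F, ⟨-, hF⟩, -⟩ := isCoveringMapOn_exp.existsUnique_continuousMap_lifts ⟨f, hf⟩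
    (a₀ := t₀) (exp_log (h t₀)) h
  exact ⟨F, fun t ↦ congrFun hF t⟩

theorem exists_hasWinding {f : unitInterval → ℂ} (hf : Continuous f) (h : ∀ t, f t ≠ 0)
    (h01 : f 0 = f 1) : ∃ m, HasWinding f m := by
  obtain ⟨ζ, hζ⟩ := exists_continuous_log hf h
  obtain ⟨m, hm⟩ := exp_eq_exp_iff_exists_int.mp ((hζ 1).trans (h01.symm.trans (hζ 0).symm))
  exact ⟨m, ζ, hζ, hm⟩

theorem HasWinding.mul {f g : unitInterval → ℂ} {m k : ℤ} (hf : HasWinding f m)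
    (hg : HasWinding g k) : HasWinding (fun t ↦ f t * g t) (m + k) := by
  obtain ⟨ζ, hζ, h1⟩ := hf
  obtain ⟨ξ, hξ, h2⟩ := hg
  refine ⟨ζ + ξ, fun t ↦ by simp [exp_add, hζ, hξ], ?_⟩
  simp only [ContinuousMap.add_apply, h1, h2]
  push_cast
  ring

theorem hasWinding_const {c : ℂ} (hc : c ≠ 0) : HasWinding (fun _ ↦ c) 0 :=
  ⟨.const _ (log c), fun _ ↦ exp_log hc, by simp⟩

theorem hasWinding_exp (m : ℤ) :
    HasWinding (fun t ↦ exp (m * (2 * Real.pi * I) * (t : ℝ))) m :=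
  ⟨⟨fun t ↦ m * (2 * Real.pi * I) * (t : ℝ), by fun_prop⟩, fun _ ↦ rfl, by simp⟩

theorem hasWinding_of_re_pos {f : unitInterval → ℂ} (hf : Continuous f) (h : ∀ t, 0 < (f t).re)
    (h01 : f 0 = f 1) : HasWinding f 0 := by
  have hs : ∀ t, f t ∈ slitPlane := fun t ↦ Or.inl (h t)
  refine ⟨⟨fun t ↦ log (f t), hf.clog hs⟩, fun t ↦ exp_log (slitPlane_ne_zero (hs t)), ?_⟩
  simp [h01]

/-- Winding numbers are invariant under homotopies of closed curves. -/
theorem HasWinding.of_homotopy {F : unitInterval × unitInterval → ℂ} (hF : Continuous F)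
    (h : ∀ p, F p ≠ 0) (h01 : ∀ s, F (s, 0) = F (s, 1)) {m : ℤ}
    (hm : HasWinding (fun t ↦ F (0, t)) m) : HasWinding (fun t ↦ F (1, t)) m := by
  obtain ⟨ζ, hζ⟩ := exists_continuous_log hF h
  obtain ⟨ξ, hξ, hξm⟩ := hm
  have hk : ∀ s, ∃ k : ℤ, ζ (s, 1) = ζ (s, 0) + k * (2 * Real.pi * I) := fun s ↦
    exp_eq_exp_iff_exists_int.mp (by rw [hζ, hζ, h01])
  choose k hk using hk
  have hdiff : ∀ t, ∃ l : ℤ, ξ t = ζ (0, t) + l * (2 * Real.pi * I) := fun t ↦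
    exp_eq_exp_iff_exists_int.mp (by rw [hζ, hξ])
  choose l hl using hdiff
  -- A continuous integer-valued function on the interval is constant.
  have key : ∀ (f : unitInterval → ℤ) (g : unitInterval → ℂ), Continuous g →
      (∀ s, g s = f s * (2 * Real.pi * I)) → f 1 = f 0 := by
    intro f g hg hfg
    have hcast : Continuous fun s ↦ (f s : ℝ) := by
      have : (fun s ↦ (f s : ℝ)) = fun s ↦ (g s / (2 * Real.pi * I)).re := by
        funext s
        rw [hfg, mul_div_cancel_right₀ _ two_pi_I_ne_zero, intCast_re]
      rw [this]
      fun_prop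
    have hf : Continuous f := Int.isClosedEmbedding_coe_real.isEmbedding.continuous_iff.mpr hcast
    exact PreconnectedSpace.constant inferInstance hf
  have k₁ := key k (fun s ↦ ζ (s, 1) - ζ (s, 0)) (by fun_prop) fun s ↦ by rw [hk s]; ring
  have k₂ := key l (fun t ↦ ξ t - ζ (0, t)) (by fun_prop) fun t ↦ by rw [hl t]; ring
  have hkm : k 0 = m := by
    apply two_pi_I_int_injective
    have e₁ := hl 0
    have e₂ := hl 1
    have e₃ := hk 0
    rw [k₂] at e₂
    linear_combination e₁ - e₂ - e₃ + hξm
  refine ⟨ζ.comp ⟨fun t ↦ (1, t), by fun_prop⟩, fun t ↦ hζ (1, t), ?_⟩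
  have := hk 1
  rw [k₁, hkm] at this
  exact this

theorem HasWinding.congr {f g : unitInterval → ℂ} {m : ℤ} (hf : HasWinding f m)
    (h : ∀ t, g t = f t) : HasWinding g m := (funext h : g = f) ▸ hf

theorem exp_coe_zero_eq_one (m : ℤ) :
    exp (m * (2 * Real.pi * I) * ((0 : unitInterval) : ℝ)) =
      exp (m * (2 * Real.pi * I) * ((1 : unitInterval) : ℝ)) := by
  simp [exp_int_mul_two_pi_mul_I]

/-- A circle run through `m` times, with the origin inside. -/
theorem hasWinding_circle {c d : ℂ} (h : ‖d‖ < ‖c‖) (m : ℤ) :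
    HasWinding (fun t ↦ c * exp (m * (2 * Real.pi * I) * (t : ℝ)) + d) m := by
  have hc : c ≠ 0 := fun h0 ↦ by
    rw [h0, norm_zero] at h
    exact absurd h (norm_nonneg d).not_gt
  have hn : ∀ t : unitInterval, ‖exp (m * (2 * Real.pi * I) * (t : ℝ))‖ = 1 := fun t ↦ by
    have : (m : ℂ) * (2 * Real.pi * I) * (t : ℝ) = ((m * (2 * Real.pi) * t : ℝ) : ℂ) * I := by
      push_cast
      ring
    rw [this, norm_exp_ofReal_mul_I]
  -- The curve factors as the centred circle times this term, which stays in the right half-plane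
  -- because `‖d‖ < ‖c‖`.
  have h1 : HasWinding (fun t ↦ 1 + d / (c * exp (m * (2 * Real.pi * I) * (t : ℝ)))) 0 := by
    refine hasWinding_of_re_pos ?_ (fun t ↦ ?_) ?_
    · refine continuous_const.add (continuous_const.div (by fun_prop) fun t ↦ ?_)
      exact mul_ne_zero hc (exp_ne_zero _)
    · have h2 : ‖d / (c * exp (m * (2 * Real.pi * I) * (t : ℝ)))‖ < 1 := by
        rw [norm_div, norm_mul, hn, mul_one, div_lt_one (norm_pos_iff.mpr hc)]
        exact h
      have h3 := (abs_re_le_norm (d / (c * exp (m * (2 * Real.pi * I) * (t : ℝ)))))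
      have h4 := neg_abs_le (d / (c * exp (m * (2 * Real.pi * I) * (t : ℝ)))).re
      rw [add_re, one_re]
      linarith
    · rw [exp_coe_zero_eq_one]
  have h5 := ((hasWinding_const hc).mul (hasWinding_exp m)).mul h1
  rw [zero_add, add_zero] at h5
  refine h5.congr fun t ↦ ?_
  have := exp_ne_zero (m * (2 * Real.pi * I) * (t : ℝ))
  field_simp

/-! ### Orthonormal frames and stereographic projection -/

section Frame

variable {v w u : E3}

theorem frame_inner (h : Orthonormal ℝ ![v, w, u]) (x y : E3) :
    inner ℝ x y = inner ℝ v x * inner ℝ v y + inner ℝ w x * inner ℝ w y +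
      inner ℝ u x * inner ℝ u y := by
  have hs : ⊤ ≤ Submodule.span ℝ (Set.range ![v, w, u]) := by
    rw [h.linearIndependent.span_eq_top_of_card_eq_finrank (by simp)]
  have := (OrthonormalBasis.mk h hs).sum_inner_mul_inner x y
  rw [OrthonormalBasis.coe_mk, Fin.sum_univ_three] at this
  rw [← this]
  simp [real_inner_comm]

theorem frame_ext (h : Orthonormal ℝ ![v, w, u]) {x y : E3} (h₁ : inner ℝ v x = inner ℝ v y)
    (h₂ : inner ℝ w x = inner ℝ w y) (h₃ : inner ℝ u x = inner ℝ u y) : x = y := by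
  rw [← sub_eq_zero, ← inner_self_eq_zero (𝕜 := ℝ), frame_inner h]
  simp [inner_sub_right, h₁, h₂, h₃]

theorem frame_relations (h : Orthonormal ℝ ![v, w, u]) :
    inner ℝ v v = (1 : ℝ) ∧ inner ℝ w w = (1 : ℝ) ∧ inner ℝ u u = (1 : ℝ) ∧
    inner ℝ v w = (0 : ℝ) ∧ inner ℝ w v = (0 : ℝ) ∧ inner ℝ v u = (0 : ℝ) ∧
    inner ℝ u v = (0 : ℝ) ∧ inner ℝ w u = (0 : ℝ) ∧ inner ℝ u w = (0 : ℝ) := by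
  have h' := orthonormal_iff_ite.mp h
  exact ⟨h' 0 0, h' 1 1, h' 2 2, h' 0 1, h' 1 0, h' 0 2, h' 2 0, h' 1 2, h' 2 1⟩

/-- The vector product `w = u × v` in the coordinates of another positively oriented frame. -/
theorem frame_cross {v' w' N : E3} (h : Orthonormal ℝ ![v, w, u])
    (hd : (Matrix.of ![v.ofLp, w.ofLp, u.ofLp]).det = 1) (h' : Orthonormal ℝ ![v', w', N])
    (hd' : (Matrix.of ![v'.ofLp, w'.ofLp, N.ofLp]).det = 1) :
    inner ℝ v' w = inner ℝ w' u * inner ℝ N v - inner ℝ N u * inner ℝ w' v ∧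
    inner ℝ w' w = inner ℝ N u * inner ℝ v' v - inner ℝ v' u * inner ℝ N v ∧
    inner ℝ N w = inner ℝ v' u * inner ℝ w' v - inner ℝ w' u * inner ℝ v' v := by
  let R : Matrix (Fin 3) (Fin 3) ℝ :=
    Matrix.of ![v.ofLp, w.ofLp, u.ofLp] * (Matrix.of ![v'.ofLp, w'.ofLp, N.ofLp]).transpose
  have hR : ∀ i j, R i j = inner ℝ (![v', w', N] j) (![v, w, u] i) := by
    intro i j
    simp only [R, Matrix.mul_apply, Matrix.transpose_apply, PiLp.inner_apply, Matrix.of_apply]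
    refine Finset.sum_congr rfl fun k _ ↦ ?_
    fin_cases i <;> fin_cases j <;> simp
  have hdet : R.det = 1 := by
    simp only [R]
    rw [Matrix.det_mul, Matrix.det_transpose, hd, hd', one_mul]
  have horth : R * R.transpose = 1 := by
    ext i j
    have h1 := frame_inner h' (![v, w, u] i) (![v, w, u] j)
    rw [Matrix.mul_apply, Fin.sum_univ_three, Matrix.one_apply, ← orthonormal_iff_ite.mp h i j, h1]
    simp only [Matrix.transpose_apply, hR]
    simp
  -- A rotation matrix equals its cofactor matrix; its middle row gives the three formulas.
  have hadj : R.adjugate = R.transpose := by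
    calc R.adjugate = R.adjugate * (R * R.transpose) := by rw [horth, mul_one]
      _ = R.transpose := by rw [← mul_assoc, Matrix.adjugate_mul, hdet, one_smul, one_mul]
  rw [Matrix.adjugate_fin_three] at hadj
  have e₀ := congrFun (congrFun hadj 0) 1
  have e₁ := congrFun (congrFun hadj 1) 1
  have e₂ := congrFun (congrFun hadj 2) 1
  simp only [Matrix.transpose_apply, hR] at e₀ e₁ e₂
  simp at e₀ e₁ e₂
  refine ⟨?_, ?_, ?_⟩ <;> linarith

/-- The component of `x` in the plane spanned by `v` and `w`, as a complex number. -/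
noncomputable def planar (v w x : E3) : ℂ := (inner ℝ v x : ℝ) + (inner ℝ w x : ℝ) * I

/-- Stereographic projection from the pole `N`. -/
noncomputable def stereo (v w N x : E3) : ℂ := planar v w x / ((1 - inner ℝ N x : ℝ) : ℂ)

/-- The inverse of stereographic projection. -/
noncomputable def stereoInv (v w N : E3) (z : ℂ) : E3 :=
  (normSq z + 1)⁻¹ • ((2 * z.re) • v + (2 * z.im) • w + (normSq z - 1) • N)

variable {N : E3}

theorem inner_lt_one_of_ne {x y : E3} (hx : ‖x‖ = 1) (hy : ‖y‖ = 1) (h : x ≠ y) :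
    inner ℝ x y < (1 : ℝ) := (inner_lt_one_iff_real_of_norm_eq_one hx hy).mpr h

theorem stereoInv_stereo (h : Orthonormal ℝ ![v, w, N]) {x : E3} (hx : ‖x‖ = 1) (hxN : N ≠ x) :
    stereoInv v w N (stereo v w N x) = x := by
  obtain ⟨h1, h2, h3, h4, h5, h6, h7, h8, h9⟩ := frame_relations h
  have hN : ‖N‖ = 1 := h.1 2
  have hlt := inner_lt_one_of_ne hN hx hxN
  have hsq := frame_inner h x x
  rw [real_inner_self_eq_norm_sq, hx] at hsq
  set a := inner ℝ v x
  set b := inner ℝ w x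
  set c := inner ℝ N x
  have hc : (1 - c) ≠ 0 := by linarith
  have hre : (stereo v w N x).re = a / (1 - c) := by
    rw [stereo, planar, div_ofReal_re]
    simp [a, c]
  have him : (stereo v w N x).im = b / (1 - c) := by
    rw [stereo, planar, div_ofReal_im]
    simp [b, c]
  have hn : normSq (stereo v w N x) = (1 + c) / (1 - c) := by
    rw [normSq_apply, hre, him]
    field_simp
    linarith
  have hn1 : ((1 + c) / (1 - c) + 1)⁻¹ = (1 - c) / 2 := by
    field_simp
    ring
  rw [stereoInv, hre, him, hn, hn1]
  apply frame_ext h <;>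
    simp only [inner_smul_right, inner_add_right, h1, h2, h3, h4, h5, h6, h7, h8, h9] <;>
    field_simp <;> ring

theorem stereoInv_inner (h : Orthonormal ℝ ![v, w, N]) (z : ℂ) :
    inner ℝ v (stereoInv v w N z) = (normSq z + 1)⁻¹ * (2 * z.re) ∧
    inner ℝ w (stereoInv v w N z) = (normSq z + 1)⁻¹ * (2 * z.im) ∧
    inner ℝ N (stereoInv v w N z) = (normSq z + 1)⁻¹ * (normSq z - 1) := by
  obtain ⟨h1, h2, h3, h4, h5, h6, h7, h8, h9⟩ := frame_relations h
  simp only [stereoInv, inner_smul_right, inner_add_right, h1, h2, h3, h4, h5, h6, h7, h8, h9]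
  refine ⟨?_, ?_, ?_⟩ <;> ring

theorem stereo_stereoInv (h : Orthonormal ℝ ![v, w, N]) (z : ℂ) :
    stereo v w N (stereoInv v w N z) = z := by
  obtain ⟨h1, h2, h3⟩ := stereoInv_inner h z
  have hp : normSq z + 1 ≠ 0 := by linarith [normSq_nonneg z]
  have h4 : 1 - (normSq z + 1)⁻¹ * (normSq z - 1) = 2 * (normSq z + 1)⁻¹ := by
    field_simp
    ring
  have hp' : ((normSq z + 1 : ℝ) : ℂ) ≠ 0 := ofReal_ne_zero.mpr hp
  rw [stereo, planar, h1, h2, h3, h4]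
  conv_rhs => rw [← re_add_im z]
  push_cast at hp' ⊢
  field_simp

theorem norm_stereoInv (h : Orthonormal ℝ ![v, w, N]) (z : ℂ) : ‖stereoInv v w N z‖ = 1 := by
  obtain ⟨h1, h2, h3⟩ := stereoInv_inner h z
  have h4 := frame_inner h (stereoInv v w N z) (stereoInv v w N z)
  have hp : normSq z + 1 ≠ 0 := by linarith [normSq_nonneg z]
  rw [real_inner_self_eq_norm_sq, h1, h2, h3] at h4
  have : ‖stereoInv v w N z‖ ^ 2 = 1 := by
    rw [h4]
    field_simp
    rw [normSq_apply]
    ring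
  exact (pow_eq_one_iff_of_nonneg (norm_nonneg _) two_ne_zero).mp this

theorem stereoInv_ne (h : Orthonormal ℝ ![v, w, N]) (z : ℂ) : stereoInv v w N z ≠ N := by
  intro h0
  obtain ⟨-, -, h3⟩ := stereoInv_inner h z
  have hp : normSq z + 1 ≠ 0 := by linarith [normSq_nonneg z]
  rw [h0, (frame_relations h).2.2.1] at h3
  field_simp at h3
  linarith

theorem stereo_injective (h : Orthonormal ℝ ![v, w, N]) {x y : E3} (hx : ‖x‖ = 1) (hy : ‖y‖ = 1)
    (hxN : N ≠ x) (hyN : N ≠ y) (hxy : stereo v w N x = stereo v w N y) : x = y := by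
  rw [← stereoInv_stereo h hx hxN, hxy, stereoInv_stereo h hy hyN]

theorem continuous_stereo_comp {T : Type*} [TopologicalSpace T] {f : T → E3} (hf : Continuous f)
    (h : ∀ t, inner ℝ N (f t) ≠ (1 : ℝ)) : Continuous fun t ↦ stereo v w N (f t) := by
  unfold stereo planar
  refine Continuous.div (by fun_prop) (by fun_prop) fun t ↦ ?_
  rw [ofReal_ne_zero]
  exact sub_ne_zero.mpr (h t).symm

theorem continuous_stereoInv : Continuous (stereoInv v w N) := by
  unfold stereoInv
  have h1 : Continuous normSq := continuous_normSq
  have h2 : Continuous fun z ↦ (normSq z + 1)⁻¹ :=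
    (h1.add continuous_const).inv₀ fun z ↦
      ne_of_gt (add_pos_of_nonneg_of_pos (normSq_nonneg z) one_pos)
  have h3 := continuous_re
  have h4 := continuous_im
  exact h2.smul ((((continuous_const.mul h3).smul continuous_const).add
    ((continuous_const.mul h4).smul continuous_const)).add
    ((h1.sub continuous_const).smul continuous_const))

end Frame

/-! ### Winding numbers of stereographically projected circles -/

/-- The point with angle `τ` on the circle of angular radius `ε` around `u`. -/
noncomputable def circlePoint (v w u : E3) (ε τ : ℝ) : E3 :=
  Real.cos ε • u + Real.sin ε • (Real.cos τ • v + Real.sin τ • w)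

section Circle

variable {v w u v' w' N : E3}

theorem inner_circlePoint (y : E3) (ε τ : ℝ) : inner ℝ y (circlePoint v w u ε τ) =
    Real.cos ε * inner ℝ y u +
      Real.sin ε * (Real.cos τ * inner ℝ y v + Real.sin τ * inner ℝ y w) := by
  simp only [circlePoint, inner_add_right, inner_smul_right]

theorem inner_self_circlePoint (h : Orthonormal ℝ ![v, w, u]) (ε τ : ℝ) :
    inner ℝ u (circlePoint v w u ε τ) = Real.cos ε := by
  obtain ⟨h1, h2, h3, h4, h5, h6, h7, h8, h9⟩ := frame_relations h
  rw [inner_circlePoint, h3, h7, h9]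
  ring

theorem norm_circlePoint (h : Orthonormal ℝ ![v, w, u]) (ε τ : ℝ) :
    ‖circlePoint v w u ε τ‖ = 1 := by
  obtain ⟨h1, h2, h3, h4, h5, h6, h7, h8, h9⟩ := frame_relations h
  have h0 := frame_inner h (circlePoint v w u ε τ) (circlePoint v w u ε τ)
  rw [real_inner_self_eq_norm_sq, inner_circlePoint, inner_circlePoint, inner_circlePoint,
    h1, h2, h3, h4, h5, h6, h7, h8, h9] at h0
  have h10 : ‖circlePoint v w u ε τ‖ ^ 2 = 1 := by
    rw [h0]
    linear_combination Real.sin ε ^ 2 * Real.sin_sq_add_cos_sq τ + Real.sin_sq_add_cos_sq ε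
  exact (pow_eq_one_iff_of_nonneg (norm_nonneg _) two_ne_zero).mp h10

theorem circlePoint_ne (h : Orthonormal ℝ ![v, w, u]) {ε : ℝ} {y : E3}
    (hy : inner ℝ u y < Real.cos ε) (τ : ℝ) : y ≠ circlePoint v w u ε τ := by
  rintro rfl
  rw [inner_self_circlePoint h] at hy
  exact lt_irrefl _ hy

theorem planar_circlePoint (ε τ : ℝ) : planar v' w' (circlePoint v w u ε τ) =
    Real.cos ε * planar v' w' u +
      Real.sin ε * (Real.cos τ * planar v' w' v + Real.sin τ * planar v' w' w) := by
  simp only [planar, inner_circlePoint]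
  push_cast
  ring

theorem normSq_planar (h : Orthonormal ℝ ![v, w, N]) (x : E3) :
    normSq (planar v w x) = ‖x‖ ^ 2 - (inner ℝ N x) ^ 2 := by
  rw [planar, normSq_add_mul_I, ← real_inner_self_eq_norm_sq, frame_inner h x x]
  ring

/-- A curve around a point is mapped by stereographic projection to a curve that runs once around
the image of the point, clockwise as the projection is seen from inside the sphere. -/
theorem hasWinding_stereo_circle_self (h : Orthonormal ℝ ![v, w, u])
    (hd : (Matrix.of ![v.ofLp, w.ofLp, u.ofLp]).det = 1) (h' : Orthonormal ℝ ![v', w', N])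
    (hd' : (Matrix.of ![v'.ofLp, w'.ofLp, N.ofLp]).det = 1) {ε : ℝ} (hε : 0 < ε)
    (hε' : ε < Real.pi) (hN : inner ℝ u N < Real.cos ε) :
    HasWinding (fun t ↦ stereo v' w' N (circlePoint v w u ε (2 * Real.pi * (t : ℝ))) -
      stereo v' w' N u) (-1) := by
  obtain ⟨h1, h2, h3, h4, h5, h6, h7, h8, h9⟩ := frame_relations h
  obtain ⟨c1, c2, c3⟩ := frame_cross h hd h' hd'
  have hu : ‖u‖ = 1 := h.1 2
  have hv : ‖v‖ = 1 := h.1 0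
  have hNn : ‖N‖ = 1 := h'.1 2
  have hcos : Real.cos ε < 1 := by
    rw [← Real.cos_zero]
    exact Real.cos_lt_cos_of_nonneg_of_le_pi le_rfl hε'.le hε
  have hcos' : -1 < Real.cos ε := by
    rw [← Real.cos_pi]
    exact Real.cos_lt_cos_of_nonneg_of_le_pi hε.le le_rfl hε'
  have hsin : 0 < Real.sin ε := Real.sin_pos_of_pos_of_lt_pi hε hε'
  rw [real_inner_comm] at hN
  have hnu := normSq_planar h' u
  rw [hu] at hnu
  have huu := frame_inner h' u u
  have huv := frame_inner h' u v
  have hvv := frame_inner h' v v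
  rw [h3] at huu
  rw [h7] at huv
  rw [h1] at hvv
  set u₁ := inner ℝ v' u
  set u₂ := inner ℝ w' u
  set u₃ := inner ℝ N u with hu₃
  set v₁ := inner ℝ v' v
  set v₂ := inner ℝ w' v
  set v₃ := inner ℝ N v with hv₃
  set w₃ := inner ℝ N w with hw₃
  -- After clearing the positive denominators, the difference of projections is `sin ε * l * exp
  -- (-iτ) - planar v' w' u * (1 - cos ε)`: a circle traversed clockwise. The analogue of `l` for
  -- `w` is `-I * l`, by the orientation of the two frames.
  let l : ℂ := planar v' w' v * ((1 - u₃ : ℝ) : ℂ) + planar v' w' u * (v₃ : ℂ)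
  have hl' : l = ((v₁ * (1 - u₃) + u₁ * v₃ : ℝ) : ℂ) + ((v₂ * (1 - u₃) + u₂ * v₃ : ℝ) : ℂ) * I := by
    simp only [l, planar]
    push_cast
    ring
  have hlw : planar v' w' w * ((1 - u₃ : ℝ) : ℂ) + planar v' w' u * (w₃ : ℂ) = -I * l := by
    have hr : inner ℝ v' w * (1 - u₃) + u₁ * w₃ = v₂ * (1 - u₃) + u₂ * v₃ := by
      rw [c1, c3]
      linear_combination -v₂ * huu + u₂ * huv
    have hi : inner ℝ w' w * (1 - u₃) + u₂ * w₃ = -(v₁ * (1 - u₃) + u₁ * v₃) := by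
      rw [c2, c3]
      linear_combination v₁ * huu - u₁ * huv
    have hr' := congrArg (fun x : ℝ ↦ (x : ℂ)) hr
    have hi' := congrArg (fun x : ℝ ↦ (x : ℂ)) hi
    rw [hl']
    simp only [planar]
    push_cast at hr' hi' ⊢
    linear_combination hr' + I * hi' + ((v₂ : ℂ) * (1 - u₃) + u₂ * v₃) * I_sq
  have hl : normSq l = (1 - u₃) ^ 2 := by
    rw [hl', normSq_add_mul_I]
    linear_combination -(1 - u₃) ^ 2 * hvv - 2 * (1 - u₃) * v₃ * huv - v₃ ^ 2 * huu
  have hpos : ∀ t : unitInterval,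
      0 < 1 - inner ℝ N (circlePoint v w u ε (2 * Real.pi * (t : ℝ))) := fun t ↦ by
    have := inner_lt_one_of_ne hNn (norm_circlePoint h ε (2 * Real.pi * (t : ℝ)))
      (circlePoint_ne h (by rw [real_inner_comm]; exact hN) _)
    linarith
  -- The squares differ by `2 (1 - u₃)(1 - cos ε)(cos ε - u₃)`, which is positive exactly because
  -- the pole lies outside the disc.
  have hlt : ‖-planar v' w' u * ((1 - Real.cos ε : ℝ) : ℂ)‖ < ‖((Real.sin ε : ℝ) : ℂ) * l‖ := by
    rw [← sq_lt_sq₀ (norm_nonneg _) (norm_nonneg _), ← normSq_eq_norm_sq, ← normSq_eq_norm_sq,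
      normSq_mul, normSq_mul, normSq_neg, hl, hnu, normSq_ofReal, normSq_ofReal]
    have k1 : 0 < 1 - Real.cos ε := by linarith
    have k2 : 0 < 1 - u₃ := by linarith
    have k3 : 0 < Real.cos ε - u₃ := by linarith
    have k4 : 0 < 2 * ((1 - u₃) * (1 - Real.cos ε) * (Real.cos ε - u₃)) := by positivity
    linear_combination k4 - (1 - u₃) ^ 2 * Real.sin_sq_add_cos_sq ε
  have hW := hasWinding_circle hlt (-1)
  have hW' : HasWinding (fun t : unitInterval ↦
      ((((1 - inner ℝ N (circlePoint v w u ε (2 * Real.pi * (t : ℝ)))) *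
        (1 - u₃))⁻¹ : ℝ) : ℂ)) 0 := by
    refine hasWinding_of_re_pos ?_ (fun t ↦ ?_) ?_
    · refine continuous_ofReal.comp (Continuous.inv₀ ?_ fun t ↦ ?_)
      · unfold circlePoint
        fun_prop
      · exact (mul_pos (hpos t) (by linarith)).ne'
    · rw [ofReal_re]
      exact inv_pos.mpr (mul_pos (hpos t) (by linarith))
    · simp [circlePoint]
  have := hW'.mul hW
  rw [zero_add] at this
  refine this.congr fun t ↦ ?_
  have hexp : exp (((-1 : ℤ) : ℂ) * (2 * Real.pi * I) * ((t : ℝ) : ℂ)) =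
      (Real.cos (2 * Real.pi * t) : ℂ) - (Real.sin (2 * Real.pi * t) : ℂ) * I := by
    rw [ofReal_cos, ofReal_sin, ← cos_neg, show ((-1 : ℤ) : ℂ) * (2 * Real.pi * I) * ((t : ℝ) : ℂ) =
      (-((2 * Real.pi * t : ℝ) : ℂ)) * I by push_cast; ring, exp_mul_I, sin_neg]
    ring
  have hn := hpos t
  rw [hexp, stereo, stereo, planar_circlePoint]
  have hn' : inner ℝ N (circlePoint v w u ε (2 * Real.pi * (t : ℝ))) = _ := inner_circlePoint N ε _
  set n := inner ℝ N (circlePoint v w u ε (2 * Real.pi * (t : ℝ)))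
  have e₁ : ((1 - n : ℝ) : ℂ) ≠ 0 := ofReal_ne_zero.mpr hn.ne'
  have e₂ : ((1 - u₃ : ℝ) : ℂ) ≠ 0 := ofReal_ne_zero.mpr (by linarith)
  rw [ofReal_inv, ofReal_mul, div_sub_div _ _ e₁ e₂, div_eq_inv_mul]
  congr 1
  rw [hn', ← hu₃, ← hv₃, ← hw₃]
  generalize Real.sin (2 * Real.pi * t) = S
  generalize Real.cos (2 * Real.pi * t) = C
  generalize Real.sin ε = s
  generalize Real.cos ε = c
  simp only [l] at hlw ⊢
  push_cast at hlw ⊢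
  linear_combination (s : ℂ) * (S : ℂ) * hlw

end Circle

section Circle

variable {v w u v' w' N : E3}

/-- Shrinking the radius to zero contracts the circle inside its disc, which contains neither `y`
nor the pole. -/
theorem hasWinding_stereo_circle_of_outside (h : Orthonormal ℝ ![v, w, u])
    (h' : Orthonormal ℝ ![v', w', N]) {ε : ℝ} (hε : 0 < ε)
    (hε' : ε < Real.pi) (hN : inner ℝ u N < Real.cos ε) {y : E3} (hy : inner ℝ u y < Real.cos ε)
    (hy₁ : ‖y‖ = 1) (hyN : N ≠ y) :
    HasWinding (fun t ↦ stereo v' w' N (circlePoint v w u ε (2 * Real.pi * (t : ℝ))) -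
      stereo v' w' N y) 0 := by
  have hN₁ : ‖N‖ = 1 := h'.1 2
  have hcos : ∀ s : unitInterval, Real.cos ε ≤ Real.cos (s * ε) := fun s ↦
    Real.cos_le_cos_of_nonneg_of_le_pi (mul_nonneg s.2.1 hε.le) hε'.le
      (mul_le_of_le_one_left hε.le s.2.2)
  have hne : ∀ (s : unitInterval) τ, N ≠ circlePoint v w u (s * ε) τ := fun s τ ↦
    circlePoint_ne h (hN.trans_le (hcos s)) τ
  have hc : Continuous fun p : unitInterval × unitInterval ↦
      circlePoint v w u (p.1 * ε) (2 * Real.pi * (p.2 : ℝ)) := by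
    unfold circlePoint
    fun_prop
  have hF := (continuous_stereo_comp (v := v') (w := w') (N := N) hc fun p ↦
    (inner_lt_one_of_ne hN₁ (norm_circlePoint h _ _) (hne p.1 _)).ne).sub
      (continuous_const (y := stereo v' w' N y))
  have key := HasWinding.of_homotopy (m := 0) hF (fun p hp ↦ ?_) (fun s ↦ ?_) ?_
  · refine key.congr fun t ↦ ?_
    simp
  · exact circlePoint_ne h (hy.trans_le (hcos p.1)) (2 * Real.pi * (p.2 : ℝ))
      (stereo_injective h' (norm_circlePoint h _ _) hy₁ (hne p.1 _) hyN (sub_eq_zero.mp hp)).symm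
  · simp [circlePoint]
  · have h0 : stereo v' w' N u - stereo v' w' N y ≠ 0 := by
      rw [sub_ne_zero]
      intro h0
      have hNu : N ≠ u := by
        simpa [circlePoint] using hne 0 0
      have := stereo_injective h' (h.1 2) hy₁ hNu hyN h0
      have hlt := hy.trans_le (Real.cos_le_one ε)
      rw [← this] at hlt
      simp only [Matrix.cons_val] at hlt
      rw [(frame_relations h).2.2.1] at hlt
      exact lt_irrefl _ hlt
    refine (hasWinding_const h0).congr fun t ↦ ?_
    simp [circlePoint]

/-- A circle about the pole projects to a counterclockwise circle about 0 of radius `sin ε / (1 -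
cos ε)`, and points outside the disc project to its interior. -/
theorem hasWinding_stereo_circle_pole (h : Orthonormal ℝ ![v, w, N]) {ε : ℝ} (hε : 0 < ε)
    (hε' : ε < Real.pi) {y : E3} (hy : inner ℝ N y < Real.cos ε) (hy₁ : ‖y‖ = 1) :
    HasWinding (fun t ↦ stereo v w N (circlePoint v w N ε (2 * Real.pi * (t : ℝ))) -
      stereo v w N y) 1 := by
  obtain ⟨h1, h2, h3, h4, h5, h6, h7, h8, h9⟩ := frame_relations h
  have hcos : Real.cos ε < 1 := by
    rw [← Real.cos_zero]
    exact Real.cos_lt_cos_of_nonneg_of_le_pi le_rfl hε'.le hε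
  have hsin : 0 < Real.sin ε := Real.sin_pos_of_pos_of_lt_pi hε hε'
  have hn := normSq_planar h y
  rw [hy₁] at hn
  have k1 : 0 < 1 - Real.cos ε := by linarith
  have k2 : 0 < 1 - inner ℝ N y := by linarith
  have k3 : 0 < Real.cos ε - inner ℝ N y := by linarith
  have hlt : ‖-stereo v w N y‖ < ‖((Real.sin ε / (1 - Real.cos ε) : ℝ) : ℂ)‖ := by
    rw [← sq_lt_sq₀ (norm_nonneg _) (norm_nonneg _), ← normSq_eq_norm_sq, ← normSq_eq_norm_sq,
      normSq_neg, stereo, normSq_div, hn, normSq_ofReal, normSq_ofReal,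
      div_mul_div_comm, div_lt_div_iff₀ (by positivity) (by positivity)]
    have k4 : 0 < 2 * ((1 - inner ℝ N y) * (1 - Real.cos ε) * (Real.cos ε - inner ℝ N y)) := by
      positivity
    linear_combination k4 - (1 - inner ℝ N y) ^ 2 * Real.sin_sq_add_cos_sq ε
  refine (hasWinding_circle hlt 1).congr fun t ↦ ?_
  have hexp : exp (((1 : ℤ) : ℂ) * (2 * Real.pi * I) * ((t : ℝ) : ℂ)) =
      (Real.cos (2 * Real.pi * t) : ℂ) + (Real.sin (2 * Real.pi * t) : ℂ) * I := by
    rw [ofReal_cos, ofReal_sin, show ((1 : ℤ) : ℂ) * (2 * Real.pi * I) * ((t : ℝ) : ℂ) =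
      ((2 * Real.pi * t : ℝ) : ℂ) * I by push_cast; ring, exp_mul_I]
  rw [hexp, sub_eq_add_neg]
  congr 1
  rw [stereo, planar, inner_self_circlePoint h, inner_circlePoint, inner_circlePoint, h1, h2, h4,
    h5, h6, h8]
  push_cast
  ring

end Circle

theorem norm_coe_sphere (x : Sphere) : ‖(x : E3)‖ = 1 := norm_eq_of_mem_sphere x

/-! ### The punctured sphere as a punctured plane -/

section Homeo

variable {v w : E3} {N : Sphere} {n : ℕ} (b : Fin n → Sphere)

/-- The stereographic images of the branch points other than the pole. -/
noncomputable def stereoBranch (v w : E3) (N : Sphere) (b : Fin n → Sphere)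
    (j : {j // b j ≠ N}) : ℂ :=
  stereo v w N (b j.1)

theorem coe_ne_coe {x y : Sphere} (h : x ≠ y) : (x : E3) ≠ y := fun h' ↦ h (Subtype.ext h')

/-- Stereographic projection as a homeomorphism between the complements of the branch points. -/
noncomputable def stereoHomeo (h : Orthonormal ℝ ![v, w, N.1]) :
    ↥((insert N (Set.range b))ᶜ) ≃ₜ ↥((Set.range (stereoBranch v w N b))ᶜ) where
  toFun x := ⟨stereo v w N x.1.1, by
    have hx : x.1 ≠ N ∧ x.1 ∉ Set.range b := not_or.mp x.2
    rintro ⟨j, hj⟩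
    exact hx.2 ⟨j.1, Subtype.ext (stereo_injective h (norm_coe_sphere _) (norm_coe_sphere _)
      (coe_ne_coe j.2.symm) (coe_ne_coe hx.1.symm) hj)⟩⟩
  invFun z := ⟨⟨stereoInv v w N z.1, mem_sphere_zero_iff_norm.mpr (norm_stereoInv h z.1)⟩, by
    have hN : (⟨stereoInv v w N z.1, mem_sphere_zero_iff_norm.mpr (norm_stereoInv h z.1)⟩ :
      Sphere) ≠ N := fun h' ↦ stereoInv_ne h z.1 (congrArg Subtype.val h')
    rintro (h' | ⟨j, hj⟩)
    · exact hN h'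
    · refine z.2 ⟨⟨j, hj ▸ hN⟩, ?_⟩
      simp only [stereoBranch, hj]
      exact stereo_stereoInv h z.1⟩
  left_inv x := by
    have hx : x.1 ≠ N ∧ x.1 ∉ Set.range b := not_or.mp x.2
    exact Subtype.ext (Subtype.ext (stereoInv_stereo h (norm_coe_sphere _) (coe_ne_coe hx.1.symm)))
  right_inv z := Subtype.ext (stereo_stereoInv h z.1)
  continuous_toFun := by
    refine Continuous.subtype_mk (continuous_stereo_comp (by fun_prop) fun x ↦ ?_) _
    have hx : x.1 ≠ N ∧ x.1 ∉ Set.range b := not_or.mp x.2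
    exact (inner_lt_one_of_ne (norm_coe_sphere _) (norm_coe_sphere _) (coe_ne_coe hx.1.symm)).ne
  continuous_invFun := by
    refine Continuous.subtype_mk (Continuous.subtype_mk ?_ _) _
    exact continuous_stereoInv.comp continuous_subtype_val

end Homeo

/-! ### Rotations and latitude-dependent twists -/

section Rotation

variable {v w N : E3}

/-- The rotation by the angle `φ` about `N`, in a frame `v`, `w`, `N`. -/
noncomputable def rotate (v w N : E3) (φ : ℝ) (x : E3) : E3 :=
  (Real.cos φ * inner ℝ v x - Real.sin φ * inner ℝ w x) • v +
    (Real.sin φ * inner ℝ v x + Real.cos φ * inner ℝ w x) • w + (inner ℝ N x : ℝ) • N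

theorem inner_rotate (h : Orthonormal ℝ ![v, w, N]) (φ : ℝ) (x : E3) :
    inner ℝ v (rotate v w N φ x) = Real.cos φ * inner ℝ v x - Real.sin φ * inner ℝ w x ∧
    inner ℝ w (rotate v w N φ x) = Real.sin φ * inner ℝ v x + Real.cos φ * inner ℝ w x ∧
    inner ℝ N (rotate v w N φ x) = inner ℝ N x := by
  obtain ⟨h1, h2, h3, h4, h5, h6, h7, h8, h9⟩ := frame_relations h
  simp only [rotate, inner_add_right, inner_smul_right, h1, h2, h3, h4, h5, h6, h7, h8, h9]
  refine ⟨?_, ?_, ?_⟩ <;> ring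

theorem norm_rotate (h : Orthonormal ℝ ![v, w, N]) (φ : ℝ) (x : E3) :
    ‖rotate v w N φ x‖ = ‖x‖ := by
  obtain ⟨h1, h2, h3⟩ := inner_rotate h φ x
  rw [← sq_eq_sq₀ (norm_nonneg _) (norm_nonneg _), ← real_inner_self_eq_norm_sq,
    ← real_inner_self_eq_norm_sq, frame_inner h (rotate v w N φ x), frame_inner h x x, h1, h2, h3]
  linear_combination ((inner ℝ v x : ℝ) ^ 2 + (inner ℝ w x : ℝ) ^ 2) * Real.sin_sq_add_cos_sq φ

theorem rotate_neg_rotate (h : Orthonormal ℝ ![v, w, N]) (φ : ℝ) (x : E3) :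
    rotate v w N (-φ) (rotate v w N φ x) = x := by
  obtain ⟨h1, h2, h3⟩ := inner_rotate h φ x
  obtain ⟨k1, k2, k3⟩ := inner_rotate h (-φ) (rotate v w N φ x)
  rw [h1, h2, Real.cos_neg, Real.sin_neg] at k1 k2
  refine frame_ext h ?_ ?_ (k3.trans h3)
  · rw [k1]
    linear_combination (inner ℝ v x : ℝ) * Real.sin_sq_add_cos_sq φ
  · rw [k2]
    linear_combination (inner ℝ w x : ℝ) * Real.sin_sq_add_cos_sq φ

theorem rotate_zero (h : Orthonormal ℝ ![v, w, N]) (x : E3) : rotate v w N 0 x = x := by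
  obtain ⟨h1, h2, h3⟩ := inner_rotate h 0 x
  refine frame_ext h ?_ ?_ h3
  · rw [h1]
    simp
  · rw [h2]
    simp

/-- The half-turn depends only on the axis; the formula is even in `N`, so it serves for `c` and for
`-c` alike. -/
theorem rotate_pi (h : Orthonormal ℝ ![v, w, N]) (x : E3) :
    rotate v w N Real.pi x = (2 * inner ℝ N x : ℝ) • N - x := by
  obtain ⟨h1, h2, h3⟩ := inner_rotate h Real.pi x
  obtain ⟨k1, k2, k3, k4, k5, k6, k7, k8, k9⟩ := frame_relations h
  refine frame_ext h ?_ ?_ ?_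
  · rw [h1, inner_sub_right, inner_smul_right, k6]
    simp
  · rw [h2, inner_sub_right, inner_smul_right, k8]
    simp
  · rw [h3, inner_sub_right, inner_smul_right, k3]
    ring

theorem stereo_rotate (h : Orthonormal ℝ ![v, w, N]) (φ : ℝ) (x : E3) :
    stereo v w N (rotate v w N φ x) = exp (φ * I) * stereo v w N x := by
  obtain ⟨h1, h2, h3⟩ := inner_rotate h φ x
  rw [stereo, stereo, planar, planar, h1, h2, h3, exp_mul_I, ← ofReal_cos, ← ofReal_sin,
    mul_div_assoc']
  congr 1
  generalize Real.sin φ = s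
  generalize Real.cos φ = c
  push_cast
  linear_combination -(s : ℂ) * (inner ℝ w x : ℝ) * I_sq

theorem continuous_rotate_comp {T : Type*} [TopologicalSpace T] {φ : T → ℝ} {f : T → E3}
    (hφ : Continuous φ) (hf : Continuous f) : Continuous fun t ↦ rotate v w N (φ t) (f t) := by
  unfold rotate
  fun_prop

/-- The homeomorphism of the sphere that rotates every circle of latitude about `N` by an angle
depending on the latitude. -/
noncomputable def twist (h : Orthonormal ℝ ![v, w, N]) (θ : C(ℝ, ℝ)) : Sphere ≃ₜ Sphere where
  toFun x := ⟨rotate v w N (θ (inner ℝ N x.1)) x.1,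
    mem_sphere_zero_iff_norm.mpr ((norm_rotate h _ _).trans (norm_coe_sphere x))⟩
  invFun x := ⟨rotate v w N (-θ (inner ℝ N x.1)) x.1,
    mem_sphere_zero_iff_norm.mpr ((norm_rotate h _ _).trans (norm_coe_sphere x))⟩
  left_inv x := Subtype.ext (by
    simp only [(inner_rotate h _ _).2.2]
    exact rotate_neg_rotate h _ _)
  right_inv x := Subtype.ext (by
    simp only [(inner_rotate h _ _).2.2]
    have := rotate_neg_rotate h (-θ (inner ℝ N x.1)) x.1
    rwa [neg_neg] at this)
  continuous_toFun := by
    refine Continuous.subtype_mk (continuous_rotate_comp ?_ ?_) _ <;> fun_prop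
  continuous_invFun := by
    refine Continuous.subtype_mk (continuous_rotate_comp ?_ ?_) _ <;> fun_prop

theorem coe_twist (h : Orthonormal ℝ ![v, w, N]) (θ : C(ℝ, ℝ)) (x : Sphere) :
    (twist h θ x).1 = rotate v w N (θ (inner ℝ N x.1)) x.1 := rfl

/-- A twist is isotopic to the identity, hence preserves winding numbers. -/
theorem HasWinding.twist (h : Orthonormal ℝ ![v, w, N]) (θ : C(ℝ, ℝ)) {γ : unitInterval → Sphere}
    (hγ : Continuous γ) (h01 : γ 0 = γ 1) (hγN : ∀ t, N ≠ (γ t).1) {y : Sphere} (hyN : N ≠ y.1)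
    (hγy : ∀ t, γ t ≠ y) {m : ℤ}
    (hm : HasWinding (fun t ↦ stereo v w N (γ t).1 - stereo v w N y.1) m) :
    HasWinding (fun t ↦ stereo v w N (BranchedCover.twist h θ (γ t)).1 -
      stereo v w N (BranchedCover.twist h θ y).1) m := by
  have hN₁ : ‖N‖ = 1 := h.1 2
  have hc : Continuous fun t ↦ stereo v w N (γ t).1 :=
    continuous_stereo_comp (by fun_prop) fun t ↦
      (inner_lt_one_of_ne hN₁ (norm_coe_sphere _) (hγN t)).ne
  let F : unitInterval × unitInterval → ℂ := fun p ↦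
    exp (((p.1 * θ (inner ℝ N (γ p.2).1) : ℝ) : ℂ) * I) * stereo v w N (γ p.2).1 -
      exp (((p.1 * θ (inner ℝ N y.1) : ℝ) : ℂ) * I) * stereo v w N y.1
  have hF : Continuous F := by
    have : Continuous fun p : unitInterval × unitInterval ↦ stereo v w N (γ p.2).1 :=
      hc.comp continuous_snd
    fun_prop
  have key := HasWinding.of_homotopy hF (fun p hp ↦ ?_) (fun s ↦ ?_) (m := m) (hm.congr fun t ↦ ?_)
  · refine key.congr fun t ↦ ?_
    rw [coe_twist, coe_twist, stereo_rotate h, stereo_rotate h]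
    simp [F]
  · simp only [F] at hp
    rw [← stereo_rotate h, ← stereo_rotate h, sub_eq_zero] at hp
    have hne : ∀ φ (x : Sphere), N ≠ x.1 → N ≠ rotate v w N φ x.1 := by
      intro φ x hx h0
      have h1 := (inner_rotate h φ x.1).2.2
      rw [← h0, (frame_relations h).2.2.1] at h1
      exact (inner_lt_one_of_ne hN₁ (norm_coe_sphere _) hx).ne h1.symm
    have heq := stereo_injective h ((norm_rotate h _ _).trans (norm_coe_sphere _))
      ((norm_rotate h _ _).trans (norm_coe_sphere _)) (hne _ _ (hγN p.2)) (hne _ _ hyN) hp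
    -- Rotations preserve latitude, so points with a common image are rotated by the same angle and
    -- were equal already.
    have hin : inner ℝ N (γ p.2).1 = inner ℝ N y.1 := by
      have := congrArg (inner ℝ N) heq
      rwa [(inner_rotate h _ _).2.2, (inner_rotate h _ _).2.2] at this
    rw [hin] at heq
    have := congrArg (rotate v w N (-(p.1 * θ (inner ℝ N y.1)))) heq
    rw [rotate_neg_rotate h, rotate_neg_rotate h] at this
    exact hγy p.2 (Subtype.ext this)
  · simp [F, h01]
  · simp [F]

theorem exists_frame (c : E3) (hc : ‖c‖ = 1) : ∃ v w : E3, Orthonormal ℝ ![v, w, c] ∧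
    (Matrix.of ![v.ofLp, w.ofLp, c.ofLp]).det = 1 := by
  obtain ⟨B, hB⟩ := Orthonormal.exists_orthonormalBasis_extension_of_card_eq (𝕜 := ℝ) (ι := Fin 3)
    (E := E3) (by simp) (v := fun _ ↦ c) (s := {2}) (by
      rw [orthonormal_iff_ite]
      rintro ⟨i, rfl⟩ ⟨j, rfl⟩
      simp [hc])
  have hB2 : B 2 = c := hB 2 rfl
  have ho : Orthonormal ℝ ![B 0, B 1, c] := by
    have : ![B 0, B 1, c] = B := by
      funext i
      fin_cases i
      · rfl
      · rfl
      · exact hB2.symm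
    rw [this]
    exact B.orthonormal
  have ho' : Orthonormal ℝ ![B 1, B 0, c] := by
    have h := frame_relations ho
    have hn : ∀ i, ‖B i‖ = 1 := B.orthonormal.1
    refine ⟨fun i ↦ ?_, fun i j hij ↦ ?_⟩
    · fin_cases i
      · exact hn 1
      · exact hn 0
      · exact hc
    · fin_cases i <;> fin_cases j <;> first | exact absurd rfl hij | simp [h]
  have hsq : (Matrix.of ![(B 0).ofLp, (B 1).ofLp, c.ofLp]).det *
      (Matrix.of ![(B 0).ofLp, (B 1).ofLp, c.ofLp]).det = 1 := by
    nth_rewrite 2 [← Matrix.det_transpose]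
    rw [← Matrix.det_mul, ← Matrix.det_one (n := Fin 3) (R := ℝ)]
    congr 1
    ext i j
    rw [Matrix.one_apply, ← orthonormal_iff_ite.mp ho i j, Matrix.mul_apply, PiLp.inner_apply]
    refine Finset.sum_congr rfl fun k _ ↦ ?_
    fin_cases i <;> fin_cases j <;> simp <;> ring
  have hswap : (Matrix.of ![(B 1).ofLp, (B 0).ofLp, c.ofLp]).det =
      -(Matrix.of ![(B 0).ofLp, (B 1).ofLp, c.ofLp]).det := by
    simp [Matrix.det_fin_three]
    ring
  rcases mul_self_eq_one_iff.mp hsq with h | h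
  · exact ⟨_, _, ho, h⟩
  · exact ⟨_, _, ho', by rw [hswap, h, neg_neg]⟩

end Rotation

/-! ### Lifts of loops to the cover -/

namespace RegularCover

variable {A : Type v} [AddCommGroup A] {B : Set Sphere}

/-- The same cover with additional points regarded as branch points. -/
def mono (P : RegularCover.{u, v} A B) {B' : Set Sphere} (h : B ⊆ B') :
    RegularCover.{u, v} A B' where
  carrier := P.carrier
  proj := P.proj
  continuous_proj := P.continuous_proj
  surjective_proj := P.surjective_proj
  proj_eq_iff := P.proj_eq_iff
  free_off_branch a y hy := P.free_off_branch a y fun h' ↦ hy (h h')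
  isCoveringMapOn := P.isCoveringMapOn.mono (Set.compl_subset_compl.mpr h)
  local_form := P.local_form

variable (P : RegularCover.{u, v} A B)

theorem vadd_injective_of_notMem {a a' : A} {y : P.carrier} (hy : P.proj y ∉ B)
    (h : a +ᵥ y = a' +ᵥ y) : a = a' := by
  have : (a - a') +ᵥ y = y := by
    rw [sub_eq_neg_add, add_vadd, h, neg_vadd_vadd]
  exact sub_eq_zero.mp (P.free_off_branch _ y hy this)

theorem exists_lift_path (γ : C(unitInterval, Sphere)) (hγ : ∀ t, γ t ∉ B) :
    ∃ Γ : C(unitInterval, P.carrier), ∀ t, P.proj (Γ t) = γ t := by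
  obtain ⟨y, hy⟩ := P.surjective_unbranchedProj ⟨γ 0, hγ 0⟩
  obtain ⟨Γ, hΓ, -⟩ := P.isCoveringMap_unbranchedProj.exists_path_lifts
    ⟨fun t ↦ ⟨γ t, hγ t⟩, by fun_prop⟩ y hy.symm
  exact ⟨⟨fun t ↦ (Γ t).1, by fun_prop⟩, fun t ↦ congrArg Subtype.val (congrFun hΓ t)⟩

/-- `φ_π` of the class of a free loop is the element carrying the starting point of any lift to its
end point. -/
theorem monodromy_ofFreeLoop_vadd {x₀ y : ↥(Bᶜ)} (δ : Path x₀ y) (γ : Path y y)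
    (Γ : C(unitInterval, P.Unbranched)) (hΓ : ∀ t, P.unbranchedProj (Γ t) = γ t) :
    P.monodromy x₀ (H1.ofFreeLoop δ γ) +ᵥ Γ 0 = Γ 1 := by
  have hq := P.isAddQuotientCoveringMap
  obtain ⟨a, ha⟩ := exists_vadd_eq hq
    ((hΓ 0).trans (γ.source.trans (γ.target.symm.trans (hΓ 1).symm)))
  obtain ⟨Δ, hΔ, hΔ0⟩ := P.isCoveringMap_unbranchedProj.exists_path_lifts
    δ.symm.toContinuousMap (Γ 0) (by
      rw [hΓ 0, γ.source]
      exact δ.symm.source)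
  have hΔ' : ∀ t, P.unbranchedProj (Δ t) = δ.symm t := fun t ↦ congrFun hΔ t
  have hac := hq.continuous_const_vadd a
  let p₁ : Path (Δ 1) (Γ 0) := (⟨Δ, hΔ0, rfl⟩ : Path (Γ 0) (Δ 1)).symm
  let p₂ : Path (Γ 0) (Γ 1) := ⟨Γ, rfl, rfl⟩
  -- The returning leg starts at `Γ 1 = a +ᵥ Γ 0`, so it is the translate by `a` of the lift of
  -- `δ.symm` that starts at `Γ 0`.
  let p₃ : Path (Γ 1) (a +ᵥ Δ 1) := ⟨⟨fun t ↦ a +ᵥ Δ t, by fun_prop⟩, by simp [hΔ0, ha], rfl⟩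
  have key := P.monodromy_ofLoop_vadd ((δ.trans γ).trans δ.symm)
    ((p₁.trans p₂).trans p₃).toContinuousMap (by
      intro t
      show P.unbranchedProj (((p₁.trans p₂).trans p₃) t) = ((δ.trans γ).trans δ.symm) t
      have h₁ : ∀ s, P.unbranchedProj (p₁ s) = δ s := fun s ↦ by
        refine (hΔ' (unitInterval.symm s)).trans ?_
        simp [Path.symm_apply]
      have h₃ : ∀ s, P.unbranchedProj (p₃ s) = δ.symm s := fun s ↦ (hq.map_vadd a).trans (hΔ' s)
      simp only [Path.trans_apply]
      split_ifs
      · exact h₁ _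
      · exact hΓ _
      · exact h₃ _)
  have e₀ : ((p₁.trans p₂).trans p₃).toContinuousMap 0 = Δ 1 := ((p₁.trans p₂).trans p₃).source
  have e₁ : ((p₁.trans p₂).trans p₃).toContinuousMap 1 = a +ᵥ Δ 1 :=
    ((p₁.trans p₂).trans p₃).target
  rw [e₀, e₁] at key
  have := vadd_right_injective hq key
  rw [H1.ofFreeLoop, this, ha]

end RegularCover

variable {A : Type v} [AddCommGroup A] {n : ℕ} {b : Fin n → Sphere}

/-- The monodromy of a loop is a linear combination of its winding numbers in the stereographic
projection from an arbitrary pole. -/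
theorem RegularCover.exists_monodromy_formula (P : RegularCover.{u, v} A (Set.range b))
    {N : Sphere} {v w : E3}
    (h : Orthonormal ℝ ![v, w, N.1]) :
    ∃ α : {j // b j ≠ N} → A, ∀ (Γ : C(unitInterval, P.carrier)),
      (∀ t, P.proj (Γ t) ∉ insert N (Set.range b)) → P.proj (Γ 0) = P.proj (Γ 1) →
      ∀ m : {j // b j ≠ N} → ℤ,
        (∀ j, HasWinding (fun t ↦ stereo v w N (P.proj (Γ t)).1 - stereoBranch v w N b j) (m j)) →
        (∑ j, m j • α j) +ᵥ Γ 0 = Γ 1 := by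
  -- Counting the pole as a branch point makes the base a punctured plane.
  let P' := P.mono (Set.subset_insert N (Set.range b))
  obtain ⟨α, hα⟩ := exists_monodromy_eq_sum_winding
    (P'.isAddQuotientCoveringMap.homeomorph_comp (stereoHomeo b h))
  refine ⟨α, fun Γ hΓ h01 m hm ↦ ?_⟩
  choose ζ hζ hζm using hm
  have := hα ⟨fun t ↦ (⟨Γ t, hΓ t⟩ : P'.Unbranched), by
    exact Continuous.subtype_mk Γ.continuous _⟩ ζ m (fun j t ↦ hζ j t) hζm
    (congrArg (stereoHomeo b h) (Subtype.ext h01))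
  exact congrArg Subtype.val this

/-! ### Local monodromies at the branch points -/

/-- The circle of angular radius `ε` around `u`. -/
noncomputable def circleMap {v w u : E3} (h : Orthonormal ℝ ![v, w, u]) (ε : ℝ) :
    C(unitInterval, Sphere) :=
  ⟨fun t ↦ ⟨circlePoint v w u ε (2 * Real.pi * (t : ℝ)),
    mem_sphere_zero_iff_norm.mpr (norm_circlePoint h _ _)⟩, by
      refine Continuous.subtype_mk ?_ _
      unfold circlePoint
      fun_prop⟩

/-- The closed disc of angular radius `ε` around `b j` contains no other branch point. -/
def IsIsolatingRadius (b : Fin n → Sphere) (j : Fin n) (ε : ℝ) : Prop :=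
  0 < ε ∧ ε < Real.pi ∧ ∀ i, i ≠ j → inner ℝ (b j).1 (b i).1 < Real.cos ε

theorem IsIsolatingRadius.cos_lt_one {j : Fin n} {ε : ℝ} (h : IsIsolatingRadius b j ε) :
    Real.cos ε < 1 := by
  rw [← Real.cos_zero]
  exact Real.cos_lt_cos_of_nonneg_of_le_pi le_rfl h.2.1.le h.1

theorem IsIsolatingRadius.circleMap_notMem {j : Fin n} {ε : ℝ} (hε : IsIsolatingRadius b j ε)
    {v w : E3} (h : Orthonormal ℝ ![v, w, (b j).1]) (t : unitInterval) :
    circleMap h ε t ∉ Set.range b := by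
  rintro ⟨i, hi⟩
  by_cases hij : i = j
  · subst hij
    have h1 := inner_self_circlePoint h ε (2 * Real.pi * (t : ℝ))
    have h2 : (b i).1 = circlePoint v w (b i) ε (2 * Real.pi * (t : ℝ)) := congrArg Subtype.val hi
    rw [← h2, (frame_relations h).2.2.1] at h1
    exact hε.cos_lt_one.ne h1.symm
  · exact circlePoint_ne h (hε.2.2 i hij) _ (congrArg Subtype.val hi)

theorem circleMap_zero_eq_one {v w u : E3} (h : Orthonormal ℝ ![v, w, u]) (ε : ℝ) :
    circleMap h ε 0 = circleMap h ε 1 := Subtype.ext (by simp [circleMap, circlePoint])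

/-- Every lift of a small circle around `b j` ends at the translate of its starting point
by `a j`. -/
def IsLocalMonodromy (P : RegularCover.{u, v} A (Set.range b)) {v w : Fin n → E3}
    (h : ∀ j, Orthonormal ℝ ![v j, w j, (b j).1]) (a : Fin n → A) : Prop :=
  ∀ j ε, IsIsolatingRadius b j ε → ∀ Γ : C(unitInterval, P.carrier),
    (∀ t, P.proj (Γ t) = circleMap (h j) ε t) → a j +ᵥ Γ 0 = Γ 1

section Local

variable (hb : Function.Injective b) (P : RegularCover.{u, v} A (Set.range b)) {v w : Fin n → E3}
  (h : ∀ j, Orthonormal ℝ ![v j, w j, (b j).1])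
  (hd : ∀ j, (Matrix.of ![(v j).ofLp, (w j).ofLp, (b j).1.ofLp]).det = 1)

include hd in
theorem hasWinding_circleMap {N : Sphere} {v' w' : E3} (h' : Orthonormal ℝ ![v', w', N.1])
    (hd' : (Matrix.of ![v'.ofLp, w'.ofLp, N.1.ofLp]).det = 1) {j : Fin n} {ε : ℝ}
    (hε : IsIsolatingRadius b j ε) (hN : inner ℝ (b j).1 N.1 < Real.cos ε) (i : {i // b i ≠ N}) :
    HasWinding (fun t ↦ stereo v' w' N (circleMap (h j) ε t).1 - stereoBranch v' w' N b i)
      (if i.1 = j then -1 else 0) := by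
  split_ifs with hij
  · subst hij
    exact hasWinding_stereo_circle_self (h i) (hd i) h' hd' hε.1 hε.2.1 hN
  · exact hasWinding_stereo_circle_of_outside (h j) h' hε.1 hε.2.1 hN (hε.2.2 _ hij)
      (norm_coe_sphere _) (coe_ne_coe i.2.symm)

include hb hd in
/-- The local monodromies do not depend on the radii, and their sum vanishes. -/
theorem exists_isLocalMonodromy (hn : 0 < n) :
    ∃ a : Fin n → A, IsLocalMonodromy P h a ∧ ∑ j, a j = 0 ∧
      ∀ (Γ : C(unitInterval, P.carrier)), (∀ t, P.proj (Γ t) ∉ Set.range b) →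
        P.proj (Γ 0) = P.proj (Γ 1) → ∃ c ∈ AddSubgroup.closure (Set.range a), c +ᵥ Γ 0 = Γ 1 := by
  let l : Fin n := ⟨0, hn⟩
  obtain ⟨α, hα⟩ := P.exists_monodromy_formula (h l)
  have hins : insert (b l) (Set.range b) = Set.range b := Set.insert_eq_of_mem ⟨l, rfl⟩
  rw [hins] at hα
  have hne : ∀ j, j ≠ l → b j ≠ b l := fun j hj h ↦ hj (hb h)
  -- With the branch point `b l` as pole, a circle about `b i` winds -1 times about its own centre
  -- only, and a circle about the pole winds once about every other branch point.
  obtain ⟨a, hal, haj⟩ : ∃ a : Fin n → A, a l = ∑ i, α i ∧ ∀ i : {i // b i ≠ b l}, a i = -α i := by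
    classical
    refine ⟨fun j ↦ if hj : b j = b l then ∑ i, α i else -α ⟨j, hj⟩, dif_pos rfl, fun i ↦ ?_⟩
    exact dif_neg i.2
  refine ⟨a, ?_, ?_, ?_⟩
  · intro j ε hε Γ hΓ
    have hΓB : ∀ t, P.proj (Γ t) ∉ Set.range b := fun t ↦ by
      rw [hΓ]
      exact hε.circleMap_notMem (h j) t
    have h01 : P.proj (Γ 0) = P.proj (Γ 1) := by
      rw [hΓ, hΓ, circleMap_zero_eq_one]
    by_cases hj : j = l
    · subst hj
      have := hα Γ hΓB h01 (fun _ ↦ 1) fun i ↦ by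
        simp only [hΓ]
        exact hasWinding_stereo_circle_pole (h _) hε.1 hε.2.1
          (hε.2.2 i.1 fun hi ↦ i.2 (congrArg b hi)) (norm_coe_sphere _)
      rw [hal]
      simpa using this
    · have := hα Γ hΓB h01 _ fun i ↦ by
        simp only [hΓ]
        exact hasWinding_circleMap h hd (h l) (hd l) hε (hε.2.2 l (Ne.symm hj)) i
      rw [haj ⟨j, hne j hj⟩, ← this]
      congr 1
      rw [Finset.sum_eq_single (⟨j, hne j hj⟩ : {i // b i ≠ b l})]
      · simp
      · intro i _ hi
        rw [if_neg fun h ↦ hi (Subtype.ext h), zero_smul]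
      · simp
  · classical
    rw [← Finset.add_sum_erase _ _ (Finset.mem_univ l), hal,
      Finset.sum_subtype (Finset.univ.erase l) (p := fun i ↦ b i ≠ b l) (by simp [hb.ne_iff]),
      Finset.sum_congr rfl fun i _ ↦ haj i, Finset.sum_neg_distrib, add_neg_cancel]
  · intro Γ hΓ h01
    have hlN : ∀ t, (b l).1 ≠ (P.proj (Γ t)).1 := fun t ↦ coe_ne_coe fun h ↦ hΓ t ⟨l, h⟩
    have hm : ∀ i : {i // b i ≠ b l}, ∃ m, HasWinding (fun t ↦
        stereo (v l) (w l) (b l) (P.proj (Γ t)).1 - stereoBranch (v l) (w l) (b l) b i) m := by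
      intro i
      refine exists_hasWinding (Continuous.sub (continuous_stereo_comp ?_ fun t ↦ ?_)
        continuous_const) (fun t ht ↦ ?_) (by rw [h01])
      · have := P.continuous_proj
        fun_prop
      · exact (inner_lt_one_of_ne (norm_coe_sphere _) (norm_coe_sphere _) (hlN t)).ne
      · exact hΓ t ⟨i, Subtype.ext (stereo_injective (h l) (norm_coe_sphere _) (norm_coe_sphere _)
          (hlN t) (coe_ne_coe i.2.symm) (sub_eq_zero.mp ht)).symm⟩
    choose m hm using hm
    refine ⟨_, ?_, hα Γ hΓ h01 m hm⟩
    refine AddSubgroup.sum_mem _ fun i _ ↦ AddSubgroup.zsmul_mem _ ?_ _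
    rw [← neg_neg (α i), ← haj]
    exact AddSubgroup.neg_mem _ (AddSubgroup.subset_closure ⟨i, rfl⟩)

end Local

/-! ### Connectedness of punctured surfaces -/

section Puncture

/-- For positive `r`, the punctured disc is the image of a half-plane under `exp`. -/
theorem isPreconnected_ball_diff_center (r : ℝ) :
    IsPreconnected (Metric.ball (0 : ℂ) r \ {0}) := by
  rcases le_or_gt r 0 with hr | hr
  · rw [Metric.ball_eq_empty.mpr hr, Set.empty_sdiff]
    exact isPreconnected_empty
  have : Metric.ball (0 : ℂ) r \ {0} = exp '' {w | w.re < Real.log r} := by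
    ext z
    simp only [Set.mem_sdiff, Metric.mem_ball, dist_zero_right, Set.mem_singleton_iff,
      Set.mem_image,
      Set.mem_ofPred_eq]
    constructor
    · rintro ⟨hz, hz0⟩
      exact ⟨log z, by rw [log_re]; exact Real.log_lt_log (norm_pos_iff.mpr hz0) hz, exp_log hz0⟩
    · rintro ⟨w, hw, rfl⟩
      exact ⟨by rw [norm_exp]; exact (Real.lt_log_iff_exp_lt hr).mp hw, exp_ne_zero w⟩
  rw [this]
  exact (convex_halfSpace_re_lt _).isPreconnected.image _ continuous_exp.continuousOn

variable {X : Type*} [TopologicalSpace X] [T1Space X]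

/-- In a separation of `S \ {y}`, the connected set `U \ {y}` lies on one side. Adding `U` to that
side gives a separation of `S`. -/
theorem isPreconnected_diff_singleton {S U : Set X} {y : X} (hS : IsPreconnected S)
    (hU : IsOpen U) (hyU : y ∈ U) (hUS : U ⊆ S) (hUy : IsPreconnected (U \ {y})) :
    IsPreconnected (S \ {y}) := by
  have key : ∀ u v : Set X, IsOpen u → IsOpen v → S \ {y} ⊆ u ∪ v → S \ {y} ∩ (u ∩ v) = ∅ →
      U \ {y} ⊆ u → S \ {y} ⊆ u ∨ S \ {y} ⊆ v := by
    intro u v hu hv huv h0 hUu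
    have h1 := isPreconnected_iff_subset_of_disjoint.mp hS (u ∪ U) (v \ {y}) (hu.union hU)
      (hv.sdiff isClosed_singleton) (by
        intro z hz
        by_cases hzy : z = y
        · exact Or.inl (Or.inr (hzy ▸ hyU))
        · rcases huv ⟨hz, hzy⟩ with h | h
          · exact Or.inl (Or.inl h)
          · exact Or.inr ⟨h, hzy⟩) (by
        rw [Set.eq_empty_iff_forall_notMem]
        rintro z ⟨hz, hzu, hzv, hzy⟩
        refine Set.eq_empty_iff_forall_notMem.mp h0 z ⟨⟨hz, hzy⟩, ?_, hzv⟩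
        exact hzu.elim id fun h ↦ hUu ⟨h, hzy⟩)
    rcases h1 with h1 | h1
    · left
      rintro z ⟨hz, hzy⟩
      exact (h1 hz).elim id fun h ↦ hUu ⟨h, hzy⟩
    · right
      exact fun z hz ↦ (h1 hz.1).1
  rw [isPreconnected_iff_subset_of_disjoint]
  intro u v hu hv huv h0
  have hUS' : U \ {y} ⊆ S \ {y} := Set.sdiff_subset_sdiff_left hUS
  rcases isPreconnected_iff_subset_of_disjoint.mp hUy u v hu hv (hUS'.trans huv)
    (Set.subset_eq_empty (Set.inter_subset_inter_left _ hUS') h0) with h | h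
  · exact key u v hu hv huv h0 h
  · exact (key v u hv hu (Set.union_comm u v ▸ huv) (Set.inter_comm u v ▸ h0) h).symm

/-- Removing finitely many points from a connected surface leaves it connected. -/
theorem isPreconnected_diff_finite {S F : Set X} (hS : IsPreconnected S) (hSo : IsOpen S)
    (hF : F.Finite) (h : ∀ y ∈ F, ∃ e : OpenPartialHomeomorph X ℂ, y ∈ e.source ∧ e y = 0) :
    IsPreconnected (S \ F) := by
  induction F, hF using Set.Finite.induction_on with
  | empty => simpa using hS
  | @insert y F hy hF ih =>
    have ih := ih fun z hz ↦ h z (Set.mem_insert_of_mem _ hz)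
    have ho : IsOpen (S \ F) := hSo.sdiff hF.isClosed
    have hins : S \ insert y F = (S \ F) \ {y} := by
      rw [Set.sdiff_sdiff, Set.union_singleton]
    rw [hins]
    by_cases hyS : y ∈ S \ F
    swap
    · rwa [Set.sdiff_singleton_eq_self hyS]
    obtain ⟨e, hye, hy0⟩ := h y (Set.mem_insert _ _)
    have hW : IsOpen (e.target ∩ e.symm ⁻¹' (S \ F)) := e.isOpen_inter_preimage_symm ho
    obtain ⟨r, hr, hrW⟩ := Metric.isOpen_iff.mp hW 0
      ⟨hy0 ▸ e.map_source hye, by rw [Set.mem_preimage, ← hy0, e.left_inv hye]; exact hyS⟩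
    have himg : (e.source ∩ e ⁻¹' Metric.ball 0 r) \ {y} = e.symm '' (Metric.ball 0 r \ {0}) := by
      ext z
      constructor
      · rintro ⟨⟨hz, hzr⟩, hzy⟩
        refine ⟨e z, ⟨hzr, fun hz0 ↦ hzy ?_⟩, e.left_inv hz⟩
        exact e.injOn hz hye (hz0.trans hy0.symm)
      · rintro ⟨x, ⟨hx, hx0⟩, rfl⟩
        have hxt := (hrW hx).1
        refine ⟨⟨e.map_target hxt, ?_⟩, fun hxy ↦ hx0 ?_⟩
        · rw [Set.mem_preimage, e.right_inv hxt]
          exact hx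
        · have hxy' : e.symm x = y := hxy
          rw [Set.mem_singleton_iff, ← hy0, ← hxy', e.right_inv hxt]
    refine isPreconnected_diff_singleton (U := e.source ∩ e ⁻¹' Metric.ball 0 r) ih
      (e.isOpen_inter_preimage Metric.isOpen_ball)
      ⟨hye, ?_⟩ ?_ ?_
    · rw [Set.mem_preimage, hy0]
      exact Metric.mem_ball_self hr
    · rintro z ⟨hz, hzr⟩
      have := (hrW hzr).2
      rwa [Set.mem_preimage, e.left_inv hz] at this
    · rw [himg]
      exact (isPreconnected_ball_diff_center r).image _
        (e.continuousOn_symm.mono fun x hx ↦ (hrW hx.1).1)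

end Puncture

/-! ### The covering group: generation by loops, conjugation by lifts -/

namespace RegularCover

variable {A : Type v} [AddCommGroup A] {B : Set Sphere} (P : RegularCover.{u, v} A B)

theorem locallyPathConnectedSpace : LocallyPathConnectedSpace P.carrier := by
  choose m hm e e' he he0 he' he0' hee' using P.local_form
  let : ChartedSpace ℂ P.carrier :=
    { atlas := Set.range e
      chartAt := e
      mem_chart_source := he
      chart_mem_atlas := fun y ↦ ⟨y, rfl⟩ }
  exact ChartedSpace.locallyPathConnectedSpace ℂ P.carrier

theorem isPathConnected_unbranched [Finite A] (hB : B.Finite) (hne : Bᶜ.Nonempty) :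
    IsPathConnected (P.proj ⁻¹' Bᶜ) := by
  have := P.locallyPathConnectedSpace
  have ho : IsOpen (P.proj ⁻¹' Bᶜ) := hB.isClosed.isOpen_compl.preimage P.continuous_proj
  rw [← ho.isConnected_iff_isPathConnected]
  refine ⟨?_, ?_⟩
  · obtain ⟨x, hx⟩ := hne
    obtain ⟨y, rfl⟩ := P.surjective_proj x
    exact ⟨y, hx⟩
  · have hF : (P.proj ⁻¹' B).Finite := by
      refine Set.Finite.preimage' hB fun x _ ↦ ?_
      obtain ⟨y, rfl⟩ := P.surjective_proj x
      refine (Set.finite_range fun a : A ↦ a +ᵥ y).subset fun z hz ↦ ?_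
      obtain ⟨a, ha⟩ := (P.proj_eq_iff y z).mp (Eq.symm hz)
      exact ⟨a, ha⟩
    rw [Set.preimage_compl, Set.compl_eq_univ_sdiff]
    refine isPreconnected_diff_finite isPreconnected_univ isOpen_univ hF fun y _ ↦ ?_
    obtain ⟨m, hm, e, e', he, he0, -⟩ := P.local_form y
    exact ⟨e, he, he0⟩

/-- If all loops act on the cover through a subgroup of `A`, that subgroup is all of `A`. -/
theorem eq_top_of_forall_loop [Finite A] (hB : B.Finite) (hne : Bᶜ.Nonempty) {H : AddSubgroup A}
    (h : ∀ Γ : C(unitInterval, P.carrier), (∀ t, P.proj (Γ t) ∉ B) →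
      P.proj (Γ 0) = P.proj (Γ 1) → ∃ c ∈ H, c +ᵥ Γ 0 = Γ 1) : H = ⊤ := by
  rw [eq_top_iff]
  intro a _
  obtain ⟨x, hx⟩ := hne
  obtain ⟨y, rfl⟩ := P.surjective_proj x
  obtain ⟨Γ, hΓ⟩ := (P.isPathConnected_unbranched hB ⟨_, hx⟩).joinedIn y hx (a +ᵥ y)
    (by rw [Set.mem_preimage, P.proj_vadd]; exact hx)
  obtain ⟨c, hc, hc'⟩ := h Γ.toContinuousMap hΓ (by
    show P.proj (Γ 0) = P.proj (Γ 1)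
    rw [Γ.source, Γ.target, P.proj_vadd])
  have hc'' : c +ᵥ Γ 0 = Γ 1 := hc'
  rw [Γ.source, Γ.target] at hc''
  rwa [← P.vadd_injective_of_notMem hx hc'']

/-- A homeomorphism of the covering surface that lifts a homeomorphism preserving the branch points
normalizes the covering group. -/
theorem exists_conj_hom [Finite A] (hB : B.Finite) (hne : Bᶜ.Nonempty) {f : Sphere ≃ₜ Sphere}
    (hf : f '' B = B) (F : P.carrier ≃ₜ P.carrier) (hF : ∀ y, P.proj (F y) = f (P.proj y)) :
    ∃ ψ : A →+ A, ∀ a y, P.proj y ∉ B → ψ a +ᵥ F y = F (a +ᵥ y) := by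
  have hq := P.isAddQuotientCoveringMap
  have hfB : ∀ {x}, x ∉ B → f x ∉ B := by
    intro x hx h
    rw [← hf] at h
    obtain ⟨z, hz, hzx⟩ := h
    exact hx (f.injective hzx ▸ hz)
  have hFB : ∀ {y}, P.proj y ∉ B → P.proj (F y) ∉ B := fun {y} hy ↦ by
    rw [hF]
    exact hfB hy
  have hpc := P.isPathConnected_unbranched hB hne
  have : PreconnectedSpace P.Unbranched :=
    isPreconnected_iff_preconnectedSpace.mp hpc.isConnected.isPreconnected
  obtain ⟨y₀, hy₀⟩ := hpc.nonempty
  let F' : P.Unbranched → P.Unbranched := fun y ↦ ⟨F y.1, hFB y.2⟩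
  have hF' : Continuous F' := by fun_prop
  have hqF : ∀ (a : A) (y : P.Unbranched),
      P.unbranchedProj (F' y) = P.unbranchedProj (F' (a +ᵥ y)) :=
    fun a y ↦ Subtype.ext (by
      show P.proj (F y.1) = P.proj (F (a +ᵥ y.1))
      rw [hF, hF, P.proj_vadd])
  have hac := hq.continuous_const_vadd
  -- The displacement from `F y` to `F (a +ᵥ y)` is constant on the connected unbranched part, so
  -- one base point determines it.
  let ψ : A → A := fun a ↦ fiberDiff A (F' ⟨y₀, hy₀⟩) (F' (a +ᵥ ⟨y₀, hy₀⟩))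
  have hψ : ∀ a y, P.proj y ∉ B → ψ a +ᵥ F y = F (a +ᵥ y) := by
    intro a y hy
    have h1 := fiberDiff_eq_of_isPreconnected hq hF' (hF'.comp (hac a)) (hqF a) ⟨y₀, hy₀⟩ ⟨y, hy⟩
    have h2 := fiberDiff_vadd hq (hqF a ⟨y, hy⟩)
    simp only [Function.comp] at h1
    rw [← h1] at h2
    exact congrArg Subtype.val h2
  refine ⟨AddMonoidHom.mk' ψ fun a a' ↦ ?_, hψ⟩
  refine P.vadd_injective_of_notMem (hFB hy₀) ?_
  rw [hψ _ _ hy₀, add_vadd, add_vadd, hψ a' _ hy₀, ← hψ a _ (by rw [P.proj_vadd]; exact hy₀)]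

end RegularCover

/-! ### Half-twists realizing transpositions of the branch points -/

variable {A : Type v} [AddCommGroup A] {n : ℕ} {b : Fin n → Sphere}

theorem exists_between_finite {ι : Type*} [Finite ι] (s : ι → ℝ) {l u : ℝ} (hlu : l < u)
    (hs : ∀ i, s i < u) : ∃ c, l < c ∧ c < u ∧ ∀ i, s i < c := by
  have : Finite (Option ι) := inferInstance
  obtain ⟨c, hc, hc'⟩ := Set.Finite.exists_between (s := Set.range (Option.elim · l s)) (t := {u})
    (Set.finite_range _) (Set.range_nonempty _) (Set.finite_singleton u)
    (Set.singleton_nonempty u) (by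
      rintro _ ⟨i, rfl⟩ _ rfl
      cases i
      · exact hlu
      · exact hs _)
  exact ⟨c, hc l ⟨none, rfl⟩, hc' u rfl, fun i ↦ hc _ ⟨some i, rfl⟩⟩

/-- There are arbitrarily small discs around a branch point. -/
theorem exists_isIsolatingRadius (hb : Function.Injective b) (j : Fin n) {N : Sphere}
    (hN : b j ≠ N) : ∃ ε, IsIsolatingRadius b j ε ∧ inner ℝ (b j).1 N.1 < Real.cos ε := by
  classical
  obtain ⟨c, hc, hc1, hcs⟩ := exists_between_finite (l := -1) (u := 1)
    (fun i : Option (Fin n) ↦ i.elim (inner ℝ (b j).1 N.1 : ℝ)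
      fun i ↦ if i = j then -1 else inner ℝ (b j).1 (b i).1) (by norm_num) (by
    rintro (_ | i)
    · exact inner_lt_one_of_ne (norm_coe_sphere _) (norm_coe_sphere _) (coe_ne_coe hN)
    · simp only [Option.elim_some]
      split_ifs with h
      · norm_num
      · exact inner_lt_one_of_ne (norm_coe_sphere _) (norm_coe_sphere _)
          (coe_ne_coe fun h' ↦ h (hb h').symm))
  have hcos : Real.cos (Real.arccos c) = c := Real.cos_arccos hc.le hc1.le
  refine ⟨Real.arccos c, ⟨Real.arccos_pos.mpr hc1, ?_, fun i hi ↦ ?_⟩, ?_⟩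
  · refine lt_of_le_of_ne (Real.arccos_le_pi c) fun h ↦ ?_
    rw [Real.arccos_eq_pi] at h
    linarith
  · rw [hcos]
    simpa [hi] using hcs (some i)
  · rw [hcos]
    exact hcs none

/-- A homeomorphism that interchanges two branch points and is isotopic to the identity
on a disc that contains no other branch point. -/
theorem exists_twist_swap {i j : Fin n} {c : Sphere}
    (hij : (2 * inner ℝ c.1 (b i).1 : ℝ) • c.1 - (b i).1 = (b j).1)
    (hk : ∀ k, k ≠ i → k ≠ j → inner ℝ c.1 (b k).1 < (inner ℝ c.1 (b i).1 : ℝ)) {v w : E3}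
    (h : Orthonormal ℝ ![v, w, (-c : Sphere).1]) :
    ∃ θ : C(ℝ, ℝ), ∀ k, twist h θ (b k) = b (Equiv.swap i j k) := by
  set N : Sphere := -c with hN
  have hNc : ∀ x : E3, inner ℝ N.1 x = -(inner ℝ c.1 x : ℝ) := fun x ↦ by
    rw [hN]
    exact inner_neg_left _ _
  have hcc : inner ℝ c.1 c.1 = (1 : ℝ) := by
    rw [real_inner_self_eq_norm_sq, norm_coe_sphere, one_pow]
  have hj : inner ℝ c.1 (b j).1 = (inner ℝ c.1 (b i).1 : ℝ) := by
    rw [← hij, inner_sub_right, inner_smul_right, hcc]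
    ring
  set κ : ℝ := inner ℝ c.1 (b i).1
  obtain ⟨μ, -, hμ, hμk⟩ := exists_between_finite (l := κ - 1) (u := κ)
    (fun k : {k // k ≠ i ∧ k ≠ j} ↦ inner ℝ c.1 (b k.1).1) (by linarith)
    (fun k ↦ hk k.1 k.2.1 k.2.2)
  have hrot : ∀ x : E3, rotate v w N Real.pi x = (2 * inner ℝ c.1 x : ℝ) • c.1 - x := fun x ↦ by
    rw [rotate_pi h, hNc]
    congr 1
    show _ • (-c.1) = _
    rw [smul_neg, ← neg_smul]
    congr 1
    ring
  -- The angle is `π` at heights at least `κ` over `c`, where `b i` and `b j` lie, and 0 at heights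
  -- at most `μ`, where all other branch points lie. The sign of `s` changes because latitude is
  -- measured from `-c`.
  refine ⟨⟨fun s ↦ Real.pi * max 0 (min 1 ((-s - μ) / (κ - μ))), by fun_prop⟩, fun k ↦ ?_⟩
  have hd : κ - μ ≠ 0 := by linarith
  have hπ : ∀ x : Sphere, inner ℝ c.1 x.1 = κ →
      twist h ⟨fun s ↦ Real.pi * max 0 (min 1 ((-s - μ) / (κ - μ))), by fun_prop⟩ x =
        rotate v w N Real.pi x.1 := by
    intro x hx
    rw [coe_twist, ContinuousMap.coe_mk, hNc, hx, neg_neg, div_self hd]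
    simp
  apply Subtype.ext
  by_cases hki : k = i
  · subst hki
    rw [hπ _ rfl, hrot, Equiv.swap_apply_left]
    exact hij
  by_cases hkj : k = j
  · subst hkj
    rw [hπ _ hj, hrot, Equiv.swap_apply_right, hj, ← hij]
    abel
  · rw [Equiv.swap_apply_of_ne_of_ne hki hkj, coe_twist, ContinuousMap.coe_mk, hNc, neg_neg]
    have h1 : (inner ℝ c.1 (b k).1 - μ) / (κ - μ) ≤ 0 :=
      div_nonpos_of_nonpos_of_nonneg (by linarith [hμk ⟨k, hki, hkj⟩]) (by linarith)
    rw [max_eq_left ((min_le_right _ _).trans h1), mul_zero, rotate_zero h]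

section Swap

variable (hb : Function.Injective b) (P : RegularCover.{u, v} A (Set.range b)) {v w : Fin n → E3}
  (h : ∀ j, Orthonormal ℝ ![v j, w j, (b j).1])
  (hd : ∀ j, (Matrix.of ![(v j).ofLp, (w j).ofLp, (b j).1.ofLp]).det = 1)

-- Conjugation by a lift of the half-twist about `c` is the required endomorphism. The monodromy
-- formula is taken with pole `-c`, which the twist fixes, so the twisted circle about `b k` has the
-- winding numbers of a circle about its image.
include hb hd in
theorem exists_hom_swap [Finite A]
    (hP : ∀ f : Sphere ≃ₜ Sphere, f '' Set.range b = Set.range b → P.Lifts f)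
    (hne : ((Set.range b)ᶜ).Nonempty) {a : Fin n → A} (ha : IsLocalMonodromy P h a)
    (hsum : ∑ k, a k = 0) {i j : Fin n} {c : Sphere}
    (hij : (2 * inner ℝ c.1 (b i).1 : ℝ) • c.1 - (b i).1 = (b j).1)
    (hk : ∀ k, k ≠ i → k ≠ j → inner ℝ c.1 (b k).1 < (inner ℝ c.1 (b i).1 : ℝ)) :
    ∃ ψ : A →+ A, ∀ k, ψ (a k) = a (Equiv.swap i j k) := by
  obtain ⟨v', w', h', hd'⟩ := exists_frame (-c : Sphere).1 (norm_coe_sphere _)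
  obtain ⟨θ, hθ⟩ := exists_twist_swap hij hk h'
  set N : Sphere := -c with hN
  set σ := Equiv.swap i j
  set f := twist h' θ
  have hf : f '' Set.range b = Set.range b := by
    rw [← Set.range_comp, show f ∘ b = b ∘ σ from funext hθ, σ.surjective.range_comp]
  obtain ⟨F, hF⟩ := hP f hf
  obtain ⟨ψ, hψ⟩ := P.exists_conj_hom (Set.finite_range b) hne hf F hF
  obtain ⟨α, hα⟩ := P.exists_monodromy_formula h'
  have hfN : ∀ {x : Sphere}, x ≠ N → f x ≠ N := by
    intro x hx hfx
    have h1 := (inner_rotate h' (θ (inner ℝ N.1 x.1)) x.1).2.2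
    rw [← coe_twist] at h1
    change inner ℝ N.1 (f x).1 = _ at h1
    rw [hfx, (frame_relations h').2.2.1] at h1
    exact (inner_lt_one_of_ne (norm_coe_sphere _) (norm_coe_sphere _)
      (coe_ne_coe hx.symm)).ne h1.symm
  have hσσ : ∀ k, σ (σ k) = k := fun k ↦ by
    rw [← Equiv.Perm.mul_apply, Equiv.swap_mul_self, Equiv.Perm.one_apply]
  have hσN : ∀ {k}, b k ≠ N → b (σ k) ≠ N := fun {k} hk ↦ hθ k ▸ hfN hk
  have hloop : ∀ k, b k ≠ N → ∃ Γ : C(unitInterval, P.carrier), ∃ ε, IsIsolatingRadius b k ε ∧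
      inner ℝ (b k).1 N.1 < Real.cos ε ∧ ∀ t, P.proj (Γ t) = circleMap (h k) ε t := by
    intro k hk
    obtain ⟨ε, hε, hεN⟩ := exists_isIsolatingRadius hb k hk
    obtain ⟨Γ, hΓ⟩ := P.exists_lift_path (circleMap (h k) ε) fun t ↦ hε.circleMap_notMem (h k) t
    exact ⟨Γ, ε, hε, hεN, hΓ⟩
  have hcircN : ∀ {k ε}, inner ℝ (b k).1 N.1 < Real.cos ε → ∀ t, circleMap (h k) ε t ≠ N :=
    fun {k ε} hε t h0 ↦ circlePoint_ne (h k) hε _ (congrArg Subtype.val h0).symm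
  have hsingle : ∀ k (hk : b k ≠ N),
      ∑ l : {l // b l ≠ N}, (if l.1 = k then (-1 : ℤ) else 0) • α l = -α ⟨k, hk⟩ := by
    intro k hk
    rw [Finset.sum_eq_single (⟨k, hk⟩ : {l // b l ≠ N})]
    · simp
    · intro l _ hl
      rw [if_neg fun h ↦ hl (Subtype.ext h), zero_smul]
    · simp
  have haα : ∀ k (hk : b k ≠ N), a k = -α ⟨k, hk⟩ := by
    intro k hk
    obtain ⟨Γ, ε, hε, hεN, hΓ⟩ := hloop k hk
    have hΓB : ∀ t, P.proj (Γ t) ∉ Set.range b := fun t ↦ hΓ t ▸ hε.circleMap_notMem (h k) t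
    have h1 := ha k ε hε Γ hΓ
    have h2 := hα Γ (fun t ht ↦ ht.elim (fun h ↦ hcircN hεN t ((hΓ t).symm.trans h)) (hΓB t))
      (by rw [hΓ, hΓ, circleMap_zero_eq_one]) _ fun l ↦ by
        simp only [hΓ]
        exact hasWinding_circleMap h hd h' hd' hε hεN l
    rw [hsingle k hk, ← h1] at h2
    exact (P.vadd_injective_of_notMem (hΓB 0) h2).symm
  have hmain : ∀ k, b k ≠ N → ψ (a k) = a (σ k) := by
    intro k hk
    obtain ⟨Γ, ε, hε, hεN, hΓ⟩ := hloop k hk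
    have hΓB : ∀ t, P.proj (Γ t) ∉ Set.range b := fun t ↦ hΓ t ▸ hε.circleMap_notMem (h k) t
    have h1 := ha k ε hε Γ hΓ
    have hfB : ∀ {x}, x ∉ Set.range b → f x ∉ Set.range b := by
      intro x hx hfx
      rw [← hf] at hfx
      obtain ⟨z, hz, hzx⟩ := hfx
      exact hx (f.injective hzx ▸ hz)
    have hFΓ : ∀ t, P.proj (F (Γ t)) = f (circleMap (h k) ε t) := fun t ↦ by rw [hF, hΓ]
    have hFB : ∀ t, P.proj (F (Γ t)) ∉ Set.range b := fun t ↦ by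
      rw [hF]
      exact hfB (hΓB t)
    have h2 := hα ⟨fun t ↦ F (Γ t), by fun_prop⟩
      (fun t ht ↦ ht.elim (fun h ↦ hfN (hcircN hεN t) ((hFΓ t).symm.trans h)) (hFB t))
      (by
        show P.proj (F (Γ 0)) = P.proj (F (Γ 1))
        rw [hFΓ, hFΓ, circleMap_zero_eq_one]) (fun l ↦ if l.1 = σ k then (-1 : ℤ) else 0) fun l ↦ by
        -- The winding number about `b l` after the twist is the one about `b (σ l)` before it.
        have h3 := hasWinding_circleMap h hd h' hd' hε hεN ⟨σ l.1, hσN l.2⟩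
        have h4 := HasWinding.twist h' θ (circleMap (h k) ε).continuous
          (circleMap_zero_eq_one (h k) ε) (fun t ↦ coe_ne_coe (hcircN hεN t).symm)
          (coe_ne_coe (hσN l.2).symm)
          (fun t ht ↦ hε.circleMap_notMem (h k) t ⟨_, ht.symm⟩) h3
        rw [hθ, hσσ] at h4
        have hiff : (σ l.1 = k) = (l.1 = σ k) := by
          rw [eq_iff_iff]
          constructor
          · rintro rfl
            exact (hσσ _).symm
          · intro h
            rw [h, hσσ]
        simp only [hiff] at h4
        refine h4.congr fun t ↦ ?_
        rw [ContinuousMap.coe_mk, hFΓ]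
        rfl
    rw [hsingle _ (hσN hk), ← haα] at h2
    have h5 : a (σ k) +ᵥ F (Γ 0) = F (Γ 1) := h2
    rw [← h1, ← hψ _ _ (hΓB 0)] at h5
    exact (P.vadd_injective_of_notMem (hFB 0) h5).symm
  refine ⟨ψ, fun k ↦ ?_⟩
  by_cases hk : b k = N
  swap
  · exact hmain k hk
  -- If the pole is itself a branch point, its index escapes the winding computation; the zero sum
  -- supplies the missing identity.
  have h6 : ∑ l, (ψ (a l) - a (σ l)) = 0 := by
    rw [Finset.sum_sub_distrib, Equiv.sum_comp σ a, ← map_sum, hsum, map_zero, sub_zero]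
  rw [Finset.sum_eq_single k] at h6
  · exact sub_eq_zero.mp h6
  · intro l _ hl
    rw [hmain l fun hlN ↦ hl (hb (hlN.trans hk.symm)), sub_self]
  · simp

include hb hd in
/-- Every permutation of the local monodromies is induced by an endomorphism of the group. -/
theorem exists_hom_perm [Finite A]
    (hP : ∀ f : Sphere ≃ₜ Sphere, f '' Set.range b = Set.range b → P.Lifts f)
    (hne : ((Set.range b)ᶜ).Nonempty) {a : Fin n → A} (ha : IsLocalMonodromy P h a)
    (hsum : ∑ k, a k = 0) (i j : Fin n) : ∃ ψ : A →+ A, ∀ k, ψ (a k) = a (Equiv.swap i j k) := by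
  let M : Submonoid (Equiv.Perm (Fin n)) :=
    { carrier := {σ | ∃ ψ : A →+ A, ∀ k, ψ (a k) = a (σ k)}
      one_mem' := ⟨.id A, fun k ↦ rfl⟩
      mul_mem' := by
        rintro σ τ ⟨ψ, hψ⟩ ⟨χ, hχ⟩
        exact ⟨ψ.comp χ, fun k ↦ by
          rw [AddMonoidHom.comp_apply, hχ, hψ, Equiv.Perm.mul_apply]⟩ }
  suffices H : ∀ i j, Equiv.swap i j ∈ M from H i j
  by_contra! hbad
  classical
  let S := Finset.univ.filter fun p : Fin n × Fin n ↦ Equiv.swap p.1 p.2 ∉ M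
  obtain ⟨i₀, j₀, h₀⟩ := hbad
  -- A bad pair at minimal distance, that is, with maximal inner product.
  obtain ⟨⟨i, j⟩, hS, hmax⟩ := S.exists_max_image (fun p ↦ (inner ℝ (b p.1).1 (b p.2).1 : ℝ))
    ⟨(i₀, j₀), by simpa [S] using h₀⟩
  have hijM : Equiv.swap i j ∉ M := by simpa [S] using hS
  have hgood : ∀ k l, (inner ℝ (b i).1 (b j).1 : ℝ) < inner ℝ (b k).1 (b l).1 →
      Equiv.swap k l ∈ M := by
    intro k l hkl
    by_contra hkl'
    exact absurd (hmax (k, l) (by simpa [S] using hkl')) (not_le.mpr hkl)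
  have hself : ∀ k, inner ℝ (b k).1 (b k).1 = (1 : ℝ) := fun k ↦ by
    rw [real_inner_self_eq_norm_sq, norm_coe_sphere, one_pow]
  have hlt : ∀ k l, k ≠ l → inner ℝ (b k).1 (b l).1 < (1 : ℝ) := fun k l hkl ↦
    inner_lt_one_of_ne (norm_coe_sphere _) (norm_coe_sphere _) (coe_ne_coe (hb.ne hkl))
  set s : E3 := (b i).1 + (b j).1 with hs
  -- A third branch point in the closed cap about the midpoint through `b i` and `b j` would be
  -- closer to each than they are to one another. Both transpositions with it would lie in `M`, and
  -- hence so would `Equiv.swap i j`.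
  have hnear : ∀ k, k ≠ i → k ≠ j → inner ℝ s (b k).1 < 1 + inner ℝ (b i).1 (b j).1 := by
    intro k hki hkj
    by_contra! hle
    rw [hs, inner_add_left] at hle
    have h1 := hgood i k (by linarith [hlt j k hkj.symm])
    have h2 := hgood k j (by
      rw [real_inner_comm (b j).1 (b k).1]
      linarith [hlt i k hki.symm])
    exact hijM (SubmonoidClass.swap_mem_trans M h1 h2)
  have hsi : inner ℝ s (b i).1 = 1 + inner ℝ (b i).1 (b j).1 := by
    rw [hs, inner_add_left, hself, real_inner_comm]
  refine hijM ?_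
  -- Antipodal points have no midpoint; any centre orthogonal to `b i` works, since `hnear` then
  -- excludes a third branch point.
  by_cases hs0 : s = 0
  · have hji : (b j).1 = -(b i).1 := eq_neg_of_add_eq_zero_right hs0
    refine exists_hom_swap hb P h hd hP hne ha hsum
      (c := ⟨v i, mem_sphere_zero_iff_norm.mpr ((h i).1 0)⟩) ?_ fun k hki hkj ↦ ?_
    · rw [(frame_relations (h i)).2.2.2.2.2.1, hji]
      simp
    · have := hnear k hki hkj
      rw [hs0, inner_zero_left, hji, inner_neg_right, hself] at this
      linarith
  · have hsn : 0 < ‖s‖ := norm_pos_iff.mpr hs0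
    have hss : ‖s‖ ^ 2 = 2 * (1 + inner ℝ (b i).1 (b j).1) := by
      rw [← real_inner_self_eq_norm_sq]
      nth_rewrite 2 [hs]
      rw [inner_add_right, hsi, hs, inner_add_left, hself]
      ring
    refine exists_hom_swap hb P h hd hP hne ha hsum
      (c := ⟨‖s‖⁻¹ • s, mem_sphere_zero_iff_norm.mpr (norm_smul_inv_norm (𝕜 := ℝ) hs0)⟩) ?_
      fun k hki hkj ↦ ?_
    · simp only [inner_smul_left, hsi]
      rw [smul_smul]
      have h7 : 2 * ((starRingEnd ℝ) ‖s‖⁻¹ * (1 + inner ℝ (b i).1 (b j).1)) * ‖s‖⁻¹ = 1 := by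
        rw [conj_trivial]
        field_simp
        linarith
      rw [h7, one_smul, hs]
      abel
    · simp only [inner_smul_left, conj_trivial]
      rw [hsi]
      exact mul_lt_mul_of_pos_left (hnear k hki hkj) (inv_pos.mpr hsn)

end Swap

/-! ### Generating families invariant under transpositions -/

section Classification

variable {A : Type v} [AddCommGroup A] {n : ℕ} {a : Fin n → A}

/-- A family all of whose transpositions extend to endomorphisms. -/
def SwapInvariant (a : Fin n → A) : Prop :=
  ∀ i j, ∃ ψ : A →+ A, ∀ k, ψ (a k) = a (Equiv.swap i j k)

/-- Subtracting from the relation its image under the transposition leaves only the terms at `i` and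
`j`. -/
theorem SwapInvariant.sub_smul_sub (h : SwapInvariant a) {c : Fin n → ℤ}
    (hc : ∑ i, c i • a i = 0) (i j : Fin n) : (c i - c j) • (a i - a j) = 0 := by
  classical
  obtain ⟨ψ, hψ⟩ := h i j
  have h1 : ∑ k, c k • a (Equiv.swap i j k) = 0 := by
    simpa [hψ] using congrArg ψ hc
  rcases eq_or_ne i j with rfl | hij
  · simp
  have h2 : ∑ k, c k • (a k - a (Equiv.swap i j k)) = 0 := by
    simp only [smul_sub, Finset.sum_sub_distrib, hc, h1, sub_zero]
  rw [Fintype.sum_eq_add i j hij fun k hk ↦ by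
    rw [Equiv.swap_apply_of_ne_of_ne hk.1 hk.2, sub_self, smul_zero], Equiv.swap_apply_left,
    Equiv.swap_apply_right, ← neg_sub (a i) (a j), smul_neg, ← sub_eq_add_neg, ← sub_smul] at h2
  exact h2

theorem SwapInvariant.zsmul_eq_zero (h : SwapInvariant a) {c : ℤ} {i : Fin n} (hc : c • a i = 0)
    (j : Fin n) : c • a j = 0 := by
  obtain ⟨ψ, hψ⟩ := h i j
  simpa [hψ] using congrArg ψ hc

/-- The transposition of `j` and `k` fixes `a i`, so one coincidence spreads to all indices. -/
theorem SwapInvariant.zsmul_eq_zsmul (h : SwapInvariant a) {c : ℤ} {i j : Fin n} (hij : i ≠ j)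
    (hc : c • a i = c • a j) (k l : Fin n) : c • a k = c • a l := by
  have key : ∀ i j k, i ≠ j → c • a i = c • a j → c • a i = c • a k := by
    intro i j k hij hc
    rcases eq_or_ne k i with rfl | hk
    · rfl
    obtain ⟨ψ, hψ⟩ := h j k
    have := congrArg ψ hc
    rwa [map_zsmul, map_zsmul, hψ, hψ, Equiv.swap_apply_of_ne_of_ne hij hk.symm,
      Equiv.swap_apply_left] at this
  rw [← key i j k hij hc, key i j l hij hc]

theorem SwapInvariant.exists_zsmul_eq_zsmul_iff (h : SwapInvariant a) {p k : ℕ} (hp : p.Prime)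
    (hn : 2 ≤ n) (hk : ∀ i, ((p ^ k : ℕ) : ℤ) • a i = 0) :
    ∃ r ≤ k, ∀ c : ℤ, ∀ i j, i ≠ j → (c • a i = c • a j ↔ ((p ^ r : ℕ) : ℤ) ∣ c) := by
  let i₀ : Fin n := ⟨0, by omega⟩
  let j₀ : Fin n := ⟨1, by omega⟩
  have h₀ : i₀ ≠ j₀ := by simp [i₀, j₀]
  obtain ⟨r, hr, hr'⟩ := (Nat.dvd_prime_pow hp).mp (addOrderOf_dvd_of_nsmul_eq_zero
    (x := a i₀ - a j₀) (n := p ^ k) (by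
      rw [← natCast_zsmul, smul_sub, hk, hk, sub_zero]))
  refine ⟨r, hr, fun c i j hij ↦ ?_⟩
  rw [← hr', addOrderOf_dvd_iff_zsmul_eq_zero, smul_sub, sub_eq_zero]
  exact ⟨fun hc ↦ h.zsmul_eq_zsmul hij hc _ _, fun hc ↦ h.zsmul_eq_zsmul h₀ hc _ _⟩

theorem exists_sum_zsmul_of_closure_eq_top (ha : AddSubgroup.closure (Set.range a) = ⊤) (y : A) :
    ∃ c : Fin n → ℤ, ∑ i, c i • a i = y := by
  have : y ∈ AddSubgroup.closure (Set.range a) := ha ▸ AddSubgroup.mem_top y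
  rw [← Submodule.span_int_eq_addSubgroupClosure] at this
  exact (Submodule.mem_span_range_iff_exists_fun ℤ).mp this

/-- All members have the same annihilator. As they generate the group, their common order is the
exponent. -/
theorem SwapInvariant.zsmul_eq_zero_iff (h : SwapInvariant a)
    (ha : AddSubgroup.closure (Set.range a) = ⊤) {N : ℕ} (hN : AddMonoid.exponent A = N) (c : ℤ)
    (i : Fin n) : c • a i = 0 ↔ (N : ℤ) ∣ c := by
  constructor
  · intro hc
    rw [← hN, Int.natCast_dvd]
    refine AddMonoid.exponent_dvd_of_forall_nsmul_eq_zero fun y ↦ ?_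
    obtain ⟨d, rfl⟩ := exists_sum_zsmul_of_closure_eq_top ha y
    have : c • ∑ i, d i • a i = 0 := by
      rw [Finset.smul_sum]
      exact Finset.sum_eq_zero fun j _ ↦ by rw [smul_comm, h.zsmul_eq_zero hc j, smul_zero]
    rcases Int.natAbs_eq c with hc' | hc' <;> rw [hc'] at this
    · simpa [natCast_zsmul] using this
    · simpa [natCast_zsmul] using this
  · rintro ⟨d, rfl⟩
    rw [mul_comm, mul_smul, natCast_zsmul, ← hN, AddMonoid.exponent_nsmul_eq_zero, smul_zero]

/-- Comparing each index with `l`, where the coefficient is zero, forces `R ∣ c i`. Every `a i` may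
then be replaced by `a l`, and only the sum of the coefficients matters. -/
theorem SwapInvariant.sum_zsmul_eq_zero_iff (h : SwapInvariant a)
    (ha : AddSubgroup.closure (Set.range a) = ⊤) {N R : ℕ} (hN : AddMonoid.exponent A = N)
    (hR : ∀ c : ℤ, ∀ i j, i ≠ j → (c • a i = c • a j ↔ (R : ℤ) ∣ c)) {l : Fin n} {c : Fin n → ℤ}
    (hl : c l = 0) : ∑ i, c i • a i = 0 ↔ (∀ i, (R : ℤ) ∣ c i) ∧ (N : ℤ) ∣ ∑ i, c i := by
  have key : (∀ i, (R : ℤ) ∣ c i) → ∑ i, c i • a i = (∑ i, c i) • a l := by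
    intro hc
    rw [Finset.sum_smul]
    refine Finset.sum_congr rfl fun i _ ↦ ?_
    rcases eq_or_ne i l with rfl | hil
    · rfl
    · exact (hR _ _ _ hil).mpr (hc i)
  constructor
  · intro hc
    have h1 : ∀ i, (R : ℤ) ∣ c i := by
      intro i
      rcases eq_or_ne i l with rfl | hil
      · simp [hl]
      · have := h.sub_smul_sub hc i l
        rw [hl, sub_zero, smul_sub, sub_eq_zero] at this
        exact (hR _ _ _ hil).mp this
    exact ⟨h1, (h.zsmul_eq_zero_iff ha hN _ l).mp (key h1 ▸ hc)⟩
  · rintro ⟨h1, h2⟩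
    rw [key h1]
    exact (h.zsmul_eq_zero_iff ha hN _ l).mpr h2

/-- Families with the same relations generate isomorphic groups. -/
theorem exists_addEquiv_of_sum_zsmul_eq_zero_iff {ι : Type*} [Fintype ι] {A' : Type*}
    [AddCommGroup A'] {f : ι → A} {g : ι → A'}
    (hf : ∀ y, ∃ c : ι → ℤ, ∑ i, c i • f i = y) (hg : ∀ y, ∃ c : ι → ℤ, ∑ i, c i • g i = y)
    (hfg : ∀ c : ι → ℤ, ∑ i, c i • f i = 0 ↔ ∑ i, c i • g i = 0) :
    ∃ θ : A ≃+ A', ∀ i, θ (f i) = g i := by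
  classical
  let F := Fintype.linearCombination ℤ f
  let G := Fintype.linearCombination ℤ g
  have hF : Function.Surjective F := hf
  have hG : Function.Surjective G := hg
  have hker : LinearMap.ker F = LinearMap.ker G := Submodule.ext hfg
  let e := (F.quotKerEquivOfSurjective hF).symm.trans
    ((Submodule.quotEquivOfEq _ _ hker).trans (G.quotKerEquivOfSurjective hG))
  have he : ∀ c, e (F c) = G c := by
    intro c
    have : (F.quotKerEquivOfSurjective hF).symm (F c) = Submodule.Quotient.mk c := by
      rw [LinearEquiv.symm_apply_eq]
      rfl
    simp only [e, LinearEquiv.trans_apply, this]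
    rfl
  refine ⟨e.toAddEquiv, fun i ↦ ?_⟩
  have := he (Pi.single i 1)
  simpa [F, G, Fintype.linearCombination_apply_single] using this

end Classification

section Classification

variable {A : Type v} [AddCommGroup A]

/-- The multiples `R • a i` all agree, so `R` times the zero sum equals `n * R` times a single
member. -/
theorem SwapInvariant.dvd_mul {n : ℕ} {a : Fin n → A} (h : SwapInvariant a)
    (ha : AddSubgroup.closure (Set.range a) = ⊤) (hsum : ∑ i, a i = 0) {N R : ℕ}
    (hN : AddMonoid.exponent A = N)
    (hR : ∀ c : ℤ, ∀ i j, i ≠ j → (c • a i = c • a j ↔ (R : ℤ) ∣ c)) (hn : 2 ≤ n) :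
    N ∣ n * R := by
  have h1 : ∑ i, (R : ℤ) • a i = ((n * R : ℕ) : ℤ) • a ⟨0, by omega⟩ := by
    rw [Finset.sum_congr rfl fun i _ ↦ show (R : ℤ) • a i = (R : ℤ) • a ⟨0, by omega⟩ from ?_,
      Finset.sum_const, Finset.card_univ, Fintype.card_fin, Nat.cast_mul, mul_smul,
      natCast_zsmul _ n]
    rcases eq_or_ne i ⟨0, by omega⟩ with rfl | hi
    · rfl
    · exact (hR _ _ _ hi).mpr dvd_rfl
  rw [← Finset.smul_sum, hsum, smul_zero] at h1
  exact_mod_cast (h.zsmul_eq_zero_iff ha hN _ _).mp h1.symm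

theorem exists_sum_castSucc_zsmul {m : ℕ} {a : Fin (m + 1) → A}
    (ha : AddSubgroup.closure (Set.range a) = ⊤) (hsum : ∑ i, a i = 0) (y : A) :
    ∃ c : Fin m → ℤ, ∑ i, c i • a i.castSucc = y := by
  obtain ⟨d, rfl⟩ := exists_sum_zsmul_of_closure_eq_top ha y
  refine ⟨fun i ↦ d i.castSucc - d (Fin.last m), ?_⟩
  have : ∑ i, (d i - d (Fin.last m)) • a i = ∑ i, d i • a i := by
    simp only [sub_smul, Finset.sum_sub_distrib, ← Finset.smul_sum, hsum, smul_zero, sub_zero]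
  rw [← this, Fin.sum_univ_castSucc, sub_self, zero_smul, add_zero]

theorem SwapInvariant.sum_castSucc_zsmul_eq_zero_iff {m : ℕ} {a : Fin (m + 1) → A}
    (h : SwapInvariant a) (ha : AddSubgroup.closure (Set.range a) = ⊤) {N R : ℕ}
    (hN : AddMonoid.exponent A = N)
    (hR : ∀ c : ℤ, ∀ i j, i ≠ j → (c • a i = c • a j ↔ (R : ℤ) ∣ c)) (c : Fin m → ℤ) :
    ∑ i, c i • a i.castSucc = 0 ↔ (∀ i, (R : ℤ) ∣ c i) ∧ (N : ℤ) ∣ ∑ i, c i := by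
  have := h.sum_zsmul_eq_zero_iff ha hN hR (l := Fin.last m) (c := Fin.snoc c 0) (by simp)
  simpa [Fin.sum_univ_castSucc, Fin.forall_fin_succ'] using this

/-- Classification of the generating families of zero sum in a finite abelian `p`-group that are
invariant under permutations. -/
theorem SwapInvariant.classification {n : ℕ} {a : Fin n → A} (h : SwapInvariant a)
    (ha : AddSubgroup.closure (Set.range a) = ⊤) (hsum : ∑ i, a i = 0) {p k : ℕ} (hp : p.Prime)
    (hA : AddMonoid.exponent A = p ^ k) (hn : 2 ≤ n) :
    (∃ θ : A ≃+ (Fin (n - 1) → ZMod (p ^ k)),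
        ∀ i : Fin (n - 1), θ (a ⟨i, by omega⟩) = Pi.single i 1) ∨
      (∃ r : ℕ, 0 < r ∧ r < k ∧ p ^ (k - r) ∣ n ∧
        ∃ θ : A ≃+ (Fin (n - 2) → ZMod (p ^ r)) × ZMod (p ^ k),
          (∀ i : Fin (n - 2), θ (a ⟨i, by omega⟩) = (Pi.single i 1, 1)) ∧
          θ (a ⟨n - 2, by omega⟩) = (0, 1)) ∨
      (p ^ k ∣ n ∧ ∃ θ : A ≃+ ZMod (p ^ k), ∀ i : Fin n, θ (a i) = 1) := by
  obtain ⟨r, hrk, hr⟩ := h.exists_zsmul_eq_zsmul_iff hp hn fun i ↦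
    (h.zsmul_eq_zero_iff ha hA _ i).mpr dvd_rfl
  have hdvd : p ^ (k - r) ∣ n := by
    have := h.dvd_mul ha hsum hA hr hn
    rw [← Nat.sub_add_cancel hrk, pow_add] at this
    exact Nat.dvd_of_mul_dvd_mul_right (pow_pos hp.pos r) this
  obtain ⟨q, rfl⟩ : ∃ q, n = q + 1 + 1 := ⟨n - 2, by omega⟩
  have hgen := exists_sum_castSucc_zsmul ha hsum
  have hrel := h.sum_castSucc_zsmul_eq_zero_iff ha hA hr
  have hsurj : ∀ N : ℕ, Function.Surjective (Int.cast : ℤ → ZMod N) := fun N ↦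
    ZMod.intCast_surjective
  -- If `r = k`, divisibility of the coefficients implies that of their sum, so the group is free
  -- over `ZMod (p ^ k)`. If `r = 0`, only the condition on the sum remains and all members
  -- coincide.
  rcases hrk.eq_or_lt with rfl | hrk'
  · left
    have hg : ∀ c : Fin (q + 1) → ℤ, ∑ i, c i • (Pi.single i 1 : Fin (q + 1) → ZMod (p ^ r)) =
        fun i ↦ (c i : ZMod (p ^ r)) := by
      intro c
      ext j
      simp [Finset.sum_apply, Pi.single_apply]
    obtain ⟨θ, hθ⟩ := exists_addEquiv_of_sum_zsmul_eq_zero_iff (f := fun i ↦ a (Fin.castSucc i))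
      (g := fun i ↦ (Pi.single i 1 : Fin (q + 1) → ZMod (p ^ r))) hgen (fun y ↦ by
        choose c hc using fun i ↦ hsurj _ (y i)
        exact ⟨c, (hg c).trans (funext hc)⟩) (fun c ↦ by
        rw [hrel, hg, funext_iff]
        simp only [Pi.zero_apply, ZMod.intCast_zmod_eq_zero_iff_dvd]
        exact and_iff_left_of_imp fun hc ↦ Finset.dvd_sum fun i _ ↦ hc i)
    exact ⟨θ, hθ⟩
  rcases Nat.eq_zero_or_pos r with rfl | hr0
  · right; right
    refine ⟨hdvd, ?_⟩
    obtain ⟨θ, hθ⟩ := exists_addEquiv_of_sum_zsmul_eq_zero_iff (f := fun i ↦ a (Fin.castSucc i))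
      (g := fun _ ↦ (1 : ZMod (p ^ k))) hgen (fun y ↦ by
        obtain ⟨c, hc⟩ := hsurj _ y
        exact ⟨Pi.single 0 c, by simp [Pi.single_apply, hc]⟩) (fun c ↦ by
        rw [hrel]
        simp [← Int.cast_sum, ZMod.intCast_zmod_eq_zero_iff_dvd])
    refine ⟨θ, fun i ↦ ?_⟩
    have hconst : a i = a (Fin.castSucc 0) := by
      rcases eq_or_ne i (Fin.castSucc 0) with rfl | hi
      · rfl
      · simpa using (hr 1 _ _ hi).mpr (by simp)
    rw [hconst, hθ]
  · right; left
    refine ⟨r, hr0, hrk', hdvd, ?_⟩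
    let g : Fin (q + 1) → (Fin q → ZMod (p ^ r)) × ZMod (p ^ k) :=
      Fin.snoc (α := fun _ ↦ (Fin q → ZMod (p ^ r)) × ZMod (p ^ k))
        (fun i ↦ (Pi.single i 1, 1)) (0, 1)
    have hg : ∀ c : Fin (q + 1) → ℤ, ∑ i, c i • g i =
        (fun i ↦ (c (Fin.castSucc i) : ZMod (p ^ r)), ((∑ i, c i : ℤ) : ZMod (p ^ k))) := by
      intro c
      rw [Fin.sum_univ_castSucc, Fin.sum_univ_castSucc]
      simp only [g, Fin.snoc_castSucc, Fin.snoc_last]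
      ext j
      · simp [Prod.fst_sum, Finset.sum_apply, Pi.single_apply]
      · simp [Prod.snd_sum]
    obtain ⟨θ, hθ⟩ := exists_addEquiv_of_sum_zsmul_eq_zero_iff (f := fun i ↦ a (Fin.castSucc i))
      (g := g) hgen (fun y ↦ by
        choose c hc using fun i ↦ hsurj _ (y.1 i)
        obtain ⟨d, hd⟩ := hsurj _ y.2
        -- The last coefficient is chosen so that the total is `d`.
        refine ⟨Fin.snoc (α := fun _ ↦ ℤ) c (d - ∑ i, c i), ?_⟩
        rw [hg]
        refine Prod.ext (funext fun i ↦ ?_) ?_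
        · simp [hc]
        · simp [Fin.sum_univ_castSucc, hd]) (fun c ↦ by
        rw [hrel, hg, Prod.mk_eq_zero, funext_iff]
        simp only [Pi.zero_apply, ZMod.intCast_zmod_eq_zero_iff_dvd]
        refine ⟨fun hc ↦ ⟨fun i ↦ hc.1 _, hc.2⟩, fun hc ↦ ⟨fun i ↦ ?_, hc.2⟩⟩
        refine Fin.lastCases ?_ hc.1 i
        -- The last coefficient has no component of its own in `ZMod (p ^ r)`; its divisibility
        -- follows from that of the sum and of the other coefficients.
        have h1 : ((p ^ r : ℕ) : ℤ) ∣ ∑ i, c i :=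
          (Int.natCast_dvd_natCast.mpr (pow_dvd_pow p hrk)).trans hc.2
        rw [Fin.sum_univ_castSucc] at h1
        exact (dvd_add_right (Finset.dvd_sum fun i _ ↦ hc.1 i)).mp h1)
    refine ⟨θ, fun i ↦ (hθ (Fin.castSucc i)).trans ?_, (hθ (Fin.last q)).trans ?_⟩
    · simp [g]
    · simp [g]

end Classification

/-! ### From homology classes of small loops to the classification -/

theorem RegularCover.monodromy_eq_of_isLoopClass {A : Type v} [AddCommGroup A] {n : ℕ}
    {b : Fin n → Sphere} (P : RegularCover.{u, v} A (Set.range b)) {x₀ : ↥((Set.range b)ᶜ)}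
    {v w : Fin n → EuclideanSpace ℝ (Fin 3)} (h : ∀ j, Orthonormal ℝ ![v j, w j, (b j).1])
    {a : Fin n → A} (ha : IsLocalMonodromy P h a) {i : Fin n} {y : ↥((Set.range b)ᶜ)}
    (δ : Path x₀ y) (γ : Path y y) {ε : ℝ} (hε : IsIsolatingRadius b i ε)
    (hγ : ∀ t, (γ t).1 = circleMap (h i) ε t) :
    P.monodromy x₀ (H1.ofFreeLoop δ γ) = a i := by
  obtain ⟨Γ, hΓ⟩ := P.exists_lift_path (circleMap (h i) ε) (hε.circleMap_notMem (h i))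
  have hmem : ∀ t, P.proj (Γ t) ∉ Set.range b := fun t ↦ hΓ t ▸ hε.circleMap_notMem (h i) t
  have h1 := P.monodromy_ofFreeLoop_vadd δ γ ⟨fun t ↦ ⟨Γ t, hmem t⟩, by fun_prop⟩ fun t ↦
    Subtype.ext ((hΓ t).trans (hγ t).symm)
  exact P.vadd_injective_of_notMem (hmem 0)
    ((congrArg Subtype.val h1).trans (ha i ε hε Γ hΓ).symm)

end BranchedCover

open BranchedCover in
theorem theorem1 {A : Type v} [AddCommGroup A] [Finite A] (p k : ℕ) (hp : p.Prime)
    (hA : AddMonoid.exponent A = p ^ k)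
    (n : ℕ) (hn : 2 ≤ n) (b : Fin n → Sphere) (hb : Function.Injective b)
    (x₀ : ↥((Set.range b)ᶜ)) (x : Fin n → H1 ↥((Set.range b)ᶜ) x₀)
    (hx : ∀ i, IsLoopClass b x₀ i (x i))
    (P : RegularCover.{u, v} A (Set.range b))
    (hP : ∀ f : Sphere ≃ₜ Sphere, f '' Set.range b = Set.range b → P.Lifts f) :
    ∃ Q : RegularCover.{u, v} A (Set.range b), P.Equivalent Q ∧
      ((∃ θ : A ≃+ (Fin (n - 1) → ZMod (p ^ k)),
          ∀ i : Fin (n - 1),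
            θ (Q.monodromy x₀ (x ⟨i, by omega⟩)) = Pi.single i 1) ∨
        (∃ r : ℕ, 0 < r ∧ r < k ∧ p ^ (k - r) ∣ n ∧
          ∃ θ : A ≃+ (Fin (n - 2) → ZMod (p ^ r)) × ZMod (p ^ k),
            (∀ i : Fin (n - 2),
              θ (Q.monodromy x₀ (x ⟨i, by omega⟩)) = (Pi.single i 1, 1)) ∧
            θ (Q.monodromy x₀ (x ⟨n - 2, by omega⟩)) = (0, 1)) ∨
        (p ^ k ∣ n ∧ ∃ θ : A ≃+ ZMod (p ^ k),
          ∀ i : Fin n, θ (Q.monodromy x₀ (x i)) = 1)) := by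
  refine ⟨P, ⟨Homeomorph.refl _, Homeomorph.refl _, by simp, fun _ ↦ rfl⟩, ?_⟩
  choose y δ γ hγ hx using hx
  choose ε v w hε0 hεπ hε h hd hγ using hγ
  have hne : ((Set.range b)ᶜ).Nonempty := ⟨x₀, x₀.2⟩
  obtain ⟨a, ha, hsum, hgen⟩ := exists_isLocalMonodromy hb P h hd (by omega)
  have hxa : ∀ i, P.monodromy x₀ (x i) = a i := fun i ↦ by
    rw [hx i]
    exact P.monodromy_eq_of_isLoopClass h ha (δ i) (γ i) ⟨hε0 i, hεπ i, hε i⟩ fun t ↦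
      Subtype.ext (hγ i t)
  have htop := P.eq_top_of_forall_loop (Set.finite_range b) hne hgen
  have hswap : SwapInvariant a := exists_hom_perm hb P h hd hP hne ha hsum
  simpa only [hxa] using hswap.classification htop hsum hp hA hn
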